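/- Let $D\subset\mathbb{R}^2$ be an open, bounded and simply connected (in particular nonempty and connected) domain with $C^\infty$ boundary $\Gamma$, meaning that near each boundary point, in suitable orthonormal coordinates, $D$ is the region above the graph of a $C^\infty$ function. Let $\nu$ be the unit normal to $\Gamma$ directed into the exterior of $D$, and let $L^2(\Gamma)$ be the space of complex-valued square-integrable functions on $\Gamma$ with respect to arc length. Let $k>0$, let $M>\max_{x\in\overline D}|x|$, and let $N\ge 0$ be an integer. For $n\in\mathbb{Z}$ and $x=(r\cos\theta,r\sin\theta)$ put $$\varphi_n(x)=\frac{2^{|n|}\,|n|!}{k^{|n|}M^{|n|}}\,J_n(kr)\,e^{\mathrm{i}n\theta},$$ where $J_n$ is the Bessel function of the first kind of order $n$. For $\mathbf{c}=(c_n)_{-N\le n\le N}\in\mathbb{C}^{2N+1}$ let $u_N=\sum_{n=-N}^{N}c_n\varphi_n$ and $$(A_N\mathbf{c})(x)=\mathrm{i}k\,u_N(x)+\frac{\partial u_N}{\partial\nu}(x),\qquad x\in\Gamma.$$ Then $A_N$ is a well-defined bounded linear operator from $\mathbb{C}^{2N+1}$ to $L^2(\Gamma)$, and it is compact and injective. 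-/

import Mathlib

open MeasureTheory Filter Topology
open scoped ContDiff

noncomputable section

/-- The Euclidean plane `ℝ²`. -/
abbrev Plane : Type := EuclideanSpace ℝ (Fin 2)

/-! ### Smooth planar domains -/

/-- `IsLocalGraph D x r γ e`: after the orthogonal change of coordinates `e`, the set `D` is,
inside the ball of radius `r` about `x`, the region above the graph of `γ`. -/
def IsLocalGraph (D : Set Plane) (x : Plane) (r : ℝ) (γ : ℝ → ℝ) (e : Plane ≃ₗᵢ[ℝ] Plane) : Prop :=
  D ∩ Metric.ball x r = {y ∈ Metric.ball x r | γ (e y 0) < e y 1}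

/-- `D` has a `C^∞` boundary: near each boundary point, in suitable orthogonal coordinates,
`D` is the region above the graph of a `C^∞` function. -/
def HasSmoothBoundary (D : Set Plane) : Prop :=
  ∀ x ∈ frontier D, ∃ r : ℝ, 0 < r ∧ ∃ γ : ℝ → ℝ, ContDiff ℝ ∞ γ ∧
    ∃ e : Plane ≃ₗᵢ[ℝ] Plane, IsLocalGraph D x r γ e

/-- An open, bounded and simply connected (in particular nonempty and connected) domain in the
plane with `C^∞` boundary. -/
structure IsSmoothSimplyConnectedDomain (D : Set Plane) : Prop where
  isOpen : IsOpen D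
  isBounded : Bornology.IsBounded D
  isSimplyConnected : IsSimplyConnected D
  smoothBoundary : HasSmoothBoundary D

/-- `n` is the outward unit normal of `D` at `x`: it has length one, every direction making an
obtuse angle with `n` enters `D`, and every direction making an acute angle with `n` leaves the
closure of `D`. -/
structure IsOutwardUnitNormal (D : Set Plane) (x n : Plane) : Prop where
  norm_eq : ‖n‖ = 1
  inward : ∀ v : Plane, inner ℝ v n < 0 → ∀ᶠ t : ℝ in 𝓝[>] 0, x + t • v ∈ D
  outward : ∀ v : Plane, 0 < inner ℝ v n → ∀ᶠ t : ℝ in 𝓝[>] 0, x + t • v ∉ closure D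

/-- There is at most one outward unit normal at a point. -/
theorem IsOutwardUnitNormal.unique {D : Set Plane} {x n m : Plane}
    (hn : IsOutwardUnitNormal D x n) (hm : IsOutwardUnitNormal D x m) : n = m := by
  by_contra hne
  have h1 : inner ℝ n m < 1 := by
    have := norm_sub_sq_real n m
    have hpos : 0 < ‖n - m‖ := norm_pos_iff.2 (sub_ne_zero.2 hne)
    rw [hn.norm_eq, hm.norm_eq] at this
    nlinarith [pow_pos hpos 2]
  have hnn : inner ℝ n n = (1 : ℝ) := by rw [real_inner_self_eq_norm_sq, hn.norm_eq]; norm_num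
  have hmm : inner ℝ m m = (1 : ℝ) := by rw [real_inner_self_eq_norm_sq, hm.norm_eq]; norm_num
  have hin := hn.inward (m - n) (by
    rw [inner_sub_left, hnn, real_inner_comm]; linarith)
  have hout := hm.outward (m - n) (by rw [inner_sub_left, hmm]; linarith)
  obtain ⟨t, ht, ht'⟩ := (hin.and hout).exists
  exact ht' (subset_closure ht)

/-- In a local graph representation the outward unit normal is the usual one,
`(γ', -1) / √(1 + γ'²)` in the rotated coordinates. -/
theorem IsLocalGraph.isOutwardUnitNormal {D : Set Plane} (hD : IsOpen D) {x : Plane}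
    (hx : x ∈ frontier D) {r : ℝ} (hr : 0 < r) {γ : ℝ → ℝ} (hγ : Differentiable ℝ γ)
    {e : Plane ≃ₗᵢ[ℝ] Plane} (h : IsLocalGraph D x r γ e) :
    IsOutwardUnitNormal D x
      (e.symm ((Real.sqrt (1 + deriv γ (e x 0) ^ 2))⁻¹ • !₂[deriv γ (e x 0), -1])) := by
  set a := deriv γ (e x 0) with ha
  have hs : 0 < Real.sqrt (1 + a ^ 2) := Real.sqrt_pos.2 (by positivity)
  have mem_iff : ∀ y ∈ Metric.ball x r, (y ∈ D ↔ γ (e y 0) < e y 1) := by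
    intro y hy
    have := Set.ext_iff.1 h y
    simp only [Set.mem_inter_iff, Set.mem_ofPred_eq, hy, and_true, true_and] at this
    exact this
  have cl : ∀ y ∈ Metric.ball x r, y ∈ closure D → γ (e y 0) ≤ e y 1 := by
    intro y hy hyc
    by_contra! hlt
    have hopen : IsOpen {z : Plane | e z 1 < γ (e z 0)} := by
      have := hγ.continuous
      exact isOpen_lt (by fun_prop) (by fun_prop)
    obtain ⟨z, ⟨hz1, hz2⟩, hzD⟩ :=
      mem_closure_iff.1 hyc _ (Metric.isOpen_ball.inter hopen) ⟨hy, hlt⟩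
    exact lt_asymm hz2 ((mem_iff z hz1).1 hzD)
  have hxb : x ∈ Metric.ball x r := Metric.mem_ball_self hr
  have hxg : e x 1 = γ (e x 0) := by
    refine le_antisymm ?_ (cl x hxb hx.1)
    have hxD : x ∉ D := by
      have := hx.2
      rwa [hD.interior_eq] at this
    exact not_lt.1 fun hlt => hxD ((mem_iff x hxb).2 hlt)
  have hinner : ∀ v : Plane,
      inner ℝ v (e.symm ((Real.sqrt (1 + a ^ 2))⁻¹ • !₂[a, -1]))
        = -((Real.sqrt (1 + a ^ 2))⁻¹ * (e v 1 - a * e v 0)) := by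
    intro v
    rw [← e.inner_map_map, e.apply_symm_apply, inner_smul_right]
    simp [PiLp.inner_apply, Fin.sum_univ_two]
    ring
  have hball : ∀ v : Plane, ∀ᶠ t : ℝ in 𝓝[>] 0, x + t • v ∈ Metric.ball x r := by
    intro v
    have hc : Continuous fun t : ℝ => x + t • v := by fun_prop
    have : Tendsto (fun t : ℝ => x + t • v) (𝓝 0) (𝓝 x) := by
      simpa using hc.tendsto 0
    exact (this.eventually (Metric.ball_mem_nhds x hr)).filter_mono nhdsWithin_le_nhds
  have hder : ∀ v : Plane, HasDerivAt
      (fun t : ℝ => e (x + t • v) 1 - γ (e (x + t • v) 0)) (e v 1 - a * e v 0) 0 := by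
    intro v
    have hlin : ∀ i, HasDerivAt (fun t : ℝ => e x i + t * e v i) (e v i) 0 := by
      intro i
      simpa using ((hasDerivAt_id (0 : ℝ)).mul_const (e v i)).const_add (e x i)
    have hg : HasDerivAt (fun t : ℝ => γ (e x 0 + t * e v 0)) (a * e v 0) 0 := by
      have h0 : HasDerivAt γ a (e x 0 + 0 * e v 0) := by
        rw [zero_mul, add_zero]
        exact (hγ (e x 0)).hasDerivAt
      exact h0.comp (0 : ℝ) (hlin 0)
    have heq : (fun t : ℝ => e (x + t • v) 1 - γ (e (x + t • v) 0)) =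
        (fun t : ℝ => e x 1 + t * e v 1) - fun t : ℝ => γ (e x 0 + t * e v 0) := by
      funext t
      simp
    rw [heq]
    exact (hlin 1).sub hg
  have hev : ∀ (g : ℝ → ℝ) (d : ℝ), HasDerivAt g d 0 → g 0 = 0 → 0 < d →
      ∀ᶠ t : ℝ in 𝓝[>] 0, 0 < g t := by
    intro g d hg hg0 hd
    have hsl := (hasDerivAt_iff_tendsto_slope.1 hg).mono_left
      (nhdsWithin_mono (0 : ℝ) (fun t (ht : 0 < t) => ht.ne'))
    filter_upwards [hsl.eventually (lt_mem_nhds hd), self_mem_nhdsWithin] with t ht htp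
    have htp : 0 < t := htp
    rw [slope_def_field, hg0, sub_zero, sub_zero] at ht
    exact (div_pos_iff_of_pos_right htp).1 ht
  refine ⟨?_, ?_, ?_⟩
  · rw [e.symm.norm_map, norm_smul, norm_inv, Real.norm_of_nonneg hs.le,
      EuclideanSpace.norm_eq]
    simp [Fin.sum_univ_two]
    rw [add_comm (a ^ 2), inv_mul_cancel₀ hs.ne']
  · intro v hv
    rw [hinner] at hv
    have hd : 0 < e v 1 - a * e v 0 := by
      by_contra! hle
      have := mul_nonpos_of_nonneg_of_nonpos (inv_pos.2 hs).le hle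
      linarith
    filter_upwards [hball v, hev _ _ (hder v) (by simp [hxg]) hd] with t ht1 ht2
    exact (mem_iff _ ht1).2 (by linarith)
  · intro v hv
    rw [hinner] at hv
    have hd : 0 < -(e v 1 - a * e v 0) := by
      by_contra! hle
      have := mul_nonneg (inv_pos.2 hs).le (show 0 ≤ e v 1 - a * e v 0 by linarith)
      linarith
    filter_upwards [hball v, hev _ _ (hder v).neg (by simp [hxg]) hd] with t ht1 ht2 hcl
    have := cl _ ht1 hcl
    simp only [Pi.neg_apply] at ht2
    linarith

open Classical in
/-- The outward unit normal field `ν` of `D`. On the boundary of a domain with smooth boundary it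
is the (unique) outward unit normal; at points without an outward normal its value is `0`. -/
def outwardNormal (D : Set Plane) (x : Plane) : Plane :=
  if h : ∃ n, IsOutwardUnitNormal D x n then h.choose else 0

/-- The default value in `outwardNormal` never occurs on the boundary of a smooth domain. -/
theorem IsSmoothSimplyConnectedDomain.isOutwardUnitNormal {D : Set Plane}
    (hD : IsSmoothSimplyConnectedDomain D) {x : Plane} (hx : x ∈ frontier D) :
    IsOutwardUnitNormal D x (outwardNormal D x) := by
  obtain ⟨r, hr, γ, hγ, e, h⟩ := hD.smoothBoundary x hx
  have hex : ∃ n, IsOutwardUnitNormal D x n :=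
    ⟨_, h.isOutwardUnitNormal hD.isOpen hx hr (hγ.differentiable (by simp))⟩
  rw [outwardNormal, dif_pos hex]
  exact hex.choose_spec

/-- The arc length (one-dimensional Hausdorff) measure on the boundary `Γ` of `D`. -/
def boundaryMeasure (D : Set Plane) : Measure Plane :=
  (Measure.hausdorffMeasure 1).restrict (frontier D)

/-! ### Fourier–Bessel functions -/

/-- The Bessel function of the first kind `J_n` of integer order `n`:
`J_n(t) = ∑_{p ≥ 0} (-1)^p / (p! (n+p)!) (t/2)^(n+2p)` for `n ≥ 0`, and `J_{-n} = (-1)^n J_n`. -/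
def besselJ (n : ℤ) (t : ℝ) : ℝ :=
  (if 0 ≤ n then 1 else (-1) ^ n.natAbs) *
    ∑' p : ℕ, (-1) ^ p / ((p.factorial : ℝ) * ((n.natAbs + p).factorial : ℝ)) *
      (t / 2) ^ (n.natAbs + 2 * p)

/-- The series defining `besselJ` converges absolutely. -/
theorem summable_besselJ (m : ℕ) (t : ℝ) : Summable fun p : ℕ =>
    (-1) ^ p / ((p.factorial : ℝ) * ((m + p).factorial : ℝ)) * (t / 2) ^ (m + 2 * p) := by
  refine Summable.of_norm_bounded
    (g := fun p : ℕ => |t / 2| ^ m * (((t / 2) ^ 2) ^ p / (p.factorial : ℝ)))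
    ((Real.summable_pow_div_factorial _).mul_left _) fun p => ?_
  have h1 : (1 : ℝ) ≤ ((m + p).factorial : ℝ) := by exact_mod_cast (m + p).factorial_pos
  have h2 : (0 : ℝ) < (p.factorial : ℝ) := by exact_mod_cast p.factorial_pos
  have h3 : ‖(-1 : ℝ) ^ p / ((p.factorial : ℝ) * ((m + p).factorial : ℝ))‖
      ≤ 1 / (p.factorial : ℝ) := by
    rw [norm_div, norm_pow, norm_neg, norm_one, one_pow, Real.norm_of_nonneg (by positivity)]
    exact one_div_le_one_div_of_le h2 (le_mul_of_one_le_right h2.le h1)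
  have h4 : ‖(t / 2) ^ (m + 2 * p)‖ = |t / 2| ^ m * ((t / 2) ^ 2) ^ p := by
    rw [norm_pow, Real.norm_eq_abs, pow_add, pow_mul, sq_abs]
  rw [norm_mul, h4]
  calc _ ≤ 1 / (p.factorial : ℝ) * (|t / 2| ^ m * ((t / 2) ^ 2) ^ p) :=
        mul_le_mul_of_nonneg_right h3 (by positivity)
    _ = _ := by ring

/-- The polar angle `θ ∈ (-π, π]` of `x = (r cos θ, r sin θ)` (and `0` at the origin). -/
def polarAngle (x : Plane) : ℝ := Complex.arg (⟨x 0, x 1⟩ : ℂ)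

/-- The Fourier–Bessel function
`φ_n(x) = 2^|n| |n|! / (k^|n| M^|n|) J_n(k r) e^{i n θ}`. -/
def fourierBessel (k M : ℝ) (n : ℤ) (x : Plane) : ℂ :=
  ((2 ^ n.natAbs * (n.natAbs.factorial : ℝ) / (k ^ n.natAbs * M ^ n.natAbs) : ℝ) : ℂ) *
    (besselJ n (k * ‖x‖) : ℂ) * Complex.exp (Complex.I * (n : ℂ) * (polarAngle x : ℂ))

/-- The coefficient space `ℂ^{2N+1}`, with coordinates indexed by `-N ≤ n ≤ N`. -/
abbrev Coeffs (N : ℕ) : Type := EuclideanSpace ℂ (Finset.Icc (-(N : ℤ)) (N : ℤ))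

/-- The Fourier–Bessel sum `u_N(x) = ∑_{n=-N}^N c_n φ_n(x)`. -/
def fourierBesselSum (k M : ℝ) (N : ℕ) (c : Coeffs N) (x : Plane) : ℂ :=
  ∑ n : Finset.Icc (-(N : ℤ)) (N : ℤ), c n * fourierBessel k M n x

/-- The Robin data `i k u_N + ∂u_N/∂ν` of the Fourier–Bessel sum with coefficients `c`, where `ν`
is the outward unit normal of `D`; it is considered at points of the boundary of `D`. -/
def robinData (D : Set Plane) (k M : ℝ) (N : ℕ) (c : Coeffs N) (x : Plane) : ℂ :=
  Complex.I * (k : ℂ) * fourierBesselSum k M N c x +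
    fderiv ℝ (fourierBesselSum k M N c) x (outwardNormal D x)

end

/-!
The operator is continuous and compact because its domain is finite-dimensional; it maps into `L²`
because the boundary has finite length and the Robin data are continuous on it. The substance is
injectivity: if `u = ∑ c_n φ_n` satisfies `∂u/∂ν = -iku` on the boundary, then `c = 0`.

Write `u = a + ib`. Both parts solve the Helmholtz equation on the whole plane, so the field
`b ∇a - a ∇b` is divergence free, while the boundary condition turns its outward flux density into
`k |u|²`. The divergence theorem therefore forces `u = 0`, hence `∂u/∂ν = 0`, on the boundary
(`IsSmoothSimplyConnectedDomain.eqOn_zero_of_impedance`). Only a one-sided form of the divergence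
theorem is needed: a field with nonnegative normal component has nonnegative total divergence, and
positive total divergence if the normal component is positive somewhere
(`IsSmoothSimplyConnectedDomain.setIntegral_divergence_nonneg`). A partition of unity reduces it to
Fubini's theorem above a graph, and no surface measure enters.

A solution with vanishing Cauchy data vanishes in `D`, and this does not require unique
continuation: since `u` is a solution on the plane, the radial derivative `φ = -(x · ∇a) / (2k²)`
solves `Δφ + k²φ = a`, and Green's second identity for `φ` and `a` gives `∫_D a² = 0`
(`IsSmoothSimplyConnectedDomain.eqOn_zero_of_cauchyData`).

Finally, the functions `J_n(kr) e^{inθ}` are real analytic on the plane, and `∂_z`, `∂_z̄` shift the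
order `n` by one (`hasFDerivAt_cylWave`). A combination that vanishes on `D` vanishes on the plane
together with all its derivatives, and the derivatives at the origin are multiples of the
coefficients (`eq_zero_of_waveSum_eqOn_zero`).
-/

/-! ### The cylindrical wave functions `J_n(kr) e^{inθ}` as entire functions -/

/-- The coefficient of `s ^ p` in the entire function `besselEntire m`. -/
noncomputable def besselCoeff (m p : ℕ) : ℂ :=
  (-1) ^ p / ((p.factorial : ℂ) * ((m + p).factorial : ℂ))

/-- The entire function `h_m(s) = ∑_p (-1)^p s^p / (p! (m+p)!)`, for which
`J_m(t) = (t/2)^m h_m((t/2)²)`. -/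
noncomputable def besselEntire (m : ℕ) (s : ℂ) : ℂ := ∑' p : ℕ, besselCoeff m p * s ^ p

theorem norm_besselCoeff_le (m p : ℕ) : ‖besselCoeff m p‖ ≤ 1 / (p.factorial : ℝ) := by
  have h1 : (1 : ℝ) ≤ ((m + p).factorial : ℝ) := by exact_mod_cast (m + p).factorial_pos
  have h2 : (0 : ℝ) < (p.factorial : ℝ) := by exact_mod_cast p.factorial_pos
  rw [besselCoeff, norm_div, norm_pow, norm_neg, norm_one, one_pow, norm_mul,
    Complex.norm_natCast, Complex.norm_natCast]
  exact one_div_le_one_div_of_le h2 (le_mul_of_one_le_right h2.le h1)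

theorem summable_besselCoeff (m : ℕ) (s : ℂ) : Summable fun p : ℕ => besselCoeff m p * s ^ p := by
  refine Summable.of_norm_bounded (Real.summable_pow_div_factorial ‖s‖) fun p => ?_
  rw [norm_mul, norm_pow, div_eq_mul_one_div, mul_comm]
  exact mul_le_mul_of_nonneg_left (norm_besselCoeff_le m p) (by positivity)

theorem succ_mul_besselCoeff_succ (m p : ℕ) :
    ((p + 1 : ℕ) : ℂ) * besselCoeff m (p + 1) = -besselCoeff (m + 1) p := by
  have h1 : ((p + 1 : ℕ) : ℂ) ≠ 0 := by exact_mod_cast p.succ_ne_zero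
  have h2 : (p.factorial : ℂ) ≠ 0 := by exact_mod_cast p.factorial_ne_zero
  have h3 : ((m + (p + 1)).factorial : ℂ) ≠ 0 := by exact_mod_cast Nat.factorial_ne_zero _
  rw [besselCoeff, besselCoeff, Nat.factorial_succ p, show m + 1 + p = m + (p + 1) by ring,
    pow_succ, Nat.cast_mul]
  field_simp

theorem add_mul_besselCoeff_succ (m p : ℕ) :
    ((m + 1 + p : ℕ) : ℂ) * besselCoeff (m + 1) p = besselCoeff m p := by
  have h1 : ((m + 1 + p : ℕ) : ℂ) ≠ 0 := by exact_mod_cast (by omega : m + 1 + p ≠ 0)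
  have h2 : (p.factorial : ℂ) ≠ 0 := by exact_mod_cast p.factorial_ne_zero
  have h3 : ((m + p).factorial : ℂ) ≠ 0 := by exact_mod_cast Nat.factorial_ne_zero _
  rw [besselCoeff, besselCoeff, show m + 1 + p = (m + p) + 1 by ring, Nat.factorial_succ (m + p),
    Nat.cast_mul]
  rw [show m + 1 + p = (m + p) + 1 by ring] at h1
  field_simp

theorem hasDerivAt_besselEntire (m : ℕ) (s : ℂ) :
    HasDerivAt (besselEntire m) (-besselEntire (m + 1) s) s := by
  set R : ℝ := ‖s‖ + 1 with hR
  have hR0 : 0 < R := by positivity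
  have hu : Summable fun p : ℕ => (p : ℝ) * (1 / (p.factorial : ℝ)) * R ^ (p - 1) := by
    rw [← summable_nat_add_iff 1]
    refine (Real.summable_pow_div_factorial R).congr fun p => ?_
    have h2 : (p.factorial : ℝ) ≠ 0 := by exact_mod_cast p.factorial_ne_zero
    have h1 : ((p + 1 : ℕ) : ℝ) ≠ 0 := by exact_mod_cast p.succ_ne_zero
    rw [Nat.factorial_succ, Nat.cast_mul, Nat.add_sub_cancel]
    field_simp
  have key := hasDerivAt_tsum_of_isPreconnected (𝕜 := ℂ) (F := ℂ)
    (g := fun p z => besselCoeff m p * z ^ p)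
    (g' := fun p z => besselCoeff m p * ((p : ℂ) * z ^ (p - 1)))
    (t := Metric.ball (0 : ℂ) R) (y₀ := s) (y := s) hu Metric.isOpen_ball
    (convex_ball (0 : ℂ) R).isPreconnected
    (fun p z _ => (hasDerivAt_pow p z).const_mul _) ?_ (by simp [hR]) (summable_besselCoeff m s)
    (by simp [hR])
  · refine key.congr_deriv (Eq.symm ?_)
    have hs : Summable fun p : ℕ => besselCoeff m p * ((p : ℂ) * s ^ (p - 1)) := by
      rw [← summable_nat_add_iff 1]
      refine (summable_besselCoeff (m + 1) s).neg.congr fun p => ?_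
      rw [Nat.add_sub_cancel, ← mul_assoc, mul_comm (besselCoeff m _), succ_mul_besselCoeff_succ]
      ring
    rw [hs.tsum_eq_zero_add, besselEntire, ← tsum_neg]
    simp only [Nat.cast_zero, zero_mul, mul_zero, zero_add]
    refine tsum_congr fun p => ?_
    rw [Nat.add_sub_cancel, ← mul_assoc, mul_comm (besselCoeff m _), succ_mul_besselCoeff_succ]
    ring
  · intro p z hz
    have hz : ‖z‖ ≤ R := by simpa using (Metric.mem_ball.1 hz).le
    rw [norm_mul, norm_mul, norm_pow, Complex.norm_natCast]
    calc _ ≤ 1 / (p.factorial : ℝ) * ((p : ℝ) * R ^ (p - 1)) := by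
          gcongr
          exact norm_besselCoeff_le m p
      _ = _ := by ring

/-- The power series form of the recurrence `J_{m+2}(t) + J_m(t) = (2(m+1)/t) J_{m+1}(t)`. -/
theorem besselEntire_recurrence (m : ℕ) (s : ℂ) :
    ((m + 1 : ℕ) : ℂ) * besselEntire (m + 1) s - s * besselEntire (m + 2) s
      = besselEntire m s := by
  have hs : Summable fun p : ℕ => (p : ℂ) * besselCoeff (m + 1) p * s ^ p := by
    rw [← summable_nat_add_iff 1]
    refine ((summable_besselCoeff (m + 2) s).mul_left (-s)).congr fun p => ?_
    rw [succ_mul_besselCoeff_succ, pow_succ]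
    ring
  have h1 : -(s * besselEntire (m + 2) s) = ∑' p : ℕ, (p : ℂ) * besselCoeff (m + 1) p * s ^ p := by
    rw [hs.tsum_eq_zero_add, besselEntire, ← tsum_mul_left, ← tsum_neg]
    simp only [Nat.cast_zero, zero_mul, zero_add]
    refine tsum_congr fun p => ?_
    rw [succ_mul_besselCoeff_succ, pow_succ]
    ring
  rw [sub_eq_add_neg, h1, besselEntire, ← tsum_mul_left,
    ← ((summable_besselCoeff (m + 1) s).mul_left _).tsum_add hs, besselEntire]
  refine tsum_congr fun p => ?_
  rw [← add_mul_besselCoeff_succ m p]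
  push_cast
  ring

theorem analyticAt_besselEntire (m : ℕ) (s : ℂ) : AnalyticAt ℂ (besselEntire m) s :=
  Differentiable.analyticAt (fun z => (hasDerivAt_besselEntire m z).differentiableAt) s

/-- The scaled complex coordinate `(k/2)(x₀ + i x₁)`, as a real linear map. -/
noncomputable def scaledZ (k : ℝ) : Plane →L[ℝ] ℂ :=
  ((k / 2 : ℝ) : ℂ) • (Complex.ofRealCLM.comp (EuclideanSpace.proj 0) +
    Complex.I • Complex.ofRealCLM.comp (EuclideanSpace.proj 1))

/-- The complex conjugate of `scaledZ`. -/
noncomputable def scaledZbar (k : ℝ) : Plane →L[ℝ] ℂ :=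
  ((k / 2 : ℝ) : ℂ) • (Complex.ofRealCLM.comp (EuclideanSpace.proj 0) -
    Complex.I • Complex.ofRealCLM.comp (EuclideanSpace.proj 1))

theorem scaledZ_apply (k : ℝ) (x : Plane) :
    scaledZ k x = ((k / 2 : ℝ) : ℂ) * (x 0 + Complex.I * x 1) := by
  simp [scaledZ, mul_add]

theorem scaledZbar_apply (k : ℝ) (x : Plane) :
    scaledZbar k x = ((k / 2 : ℝ) : ℂ) * (x 0 - Complex.I * x 1) := by
  simp [scaledZbar]

/-- The cylindrical wave function `J_n(kr) e^{inθ}`, written as a power series in the complex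
coordinate and its conjugate. -/
noncomputable def cylWave (k : ℝ) : ℤ → Plane → ℂ
  | .ofNat m, x => scaledZ k x ^ m * besselEntire m (scaledZ k x * scaledZbar k x)
  | .negSucc m, x => (-scaledZbar k x) ^ (m + 1) *
      besselEntire (m + 1) (scaledZ k x * scaledZbar k x)

theorem hasFDerivAt_mul_besselEntire (k : ℝ) (m : ℕ) (x : Plane) :
    HasFDerivAt (fun x => besselEntire m (scaledZ k x * scaledZbar k x))
      ((-besselEntire (m + 1) (scaledZ k x * scaledZbar k x)) •
        (scaledZ k x • scaledZbar k + scaledZbar k x • scaledZ k)) x :=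
  (hasDerivAt_besselEntire m _).comp_hasFDerivAt x
    ((scaledZ k).hasFDerivAt.mul (scaledZbar k).hasFDerivAt)

/-- The ladder relations `∂_z` and `∂_z̄` shift the order of the wave functions by one. -/
theorem hasFDerivAt_cylWave (k : ℝ) (n : ℤ) (x : Plane) :
    HasFDerivAt (cylWave k n)
      (cylWave k (n - 1) x • scaledZ k - cylWave k (n + 1) x • scaledZbar k) x := by
  rcases n with m | m
  · have h := ((scaledZ k).hasFDerivAt (x := x)).pow m |>.mul (hasFDerivAt_mul_besselEntire k m x)
    refine h.congr_fderiv ?_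
    rcases m with _ | m
    · have e1 : (Int.ofNat 0 - 1 : ℤ) = Int.negSucc 0 := rfl
      have e2 : (Int.ofNat 0 + 1 : ℤ) = Int.ofNat 1 := rfl
      ext v
      simp only [e1, e2, cylWave]
      simp
      ring
    · have hr := besselEntire_recurrence m (scaledZ k x * scaledZbar k x)
      have e1 : (Int.ofNat (m + 1) - 1 : ℤ) = Int.ofNat m := by simp
      have e2 : (Int.ofNat (m + 1) + 1 : ℤ) = Int.ofNat (m + 2) := by simp; ring
      ext v
      simp only [e1, e2, cylWave, ← hr]
      simp
      ring
  · have h := ((scaledZbar k).hasFDerivAt (x := x)).neg.pow (m + 1) |>.mul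
      (hasFDerivAt_mul_besselEntire k (m + 1) x)
    refine h.congr_fderiv ?_
    have e1 : (Int.negSucc m - 1 : ℤ) = Int.negSucc (m + 1) := rfl
    have hr := besselEntire_recurrence m (scaledZ k x * scaledZbar k x)
    have e3 : cylWave k (Int.negSucc m + 1) x = (-scaledZbar k x) ^ m *
        besselEntire m (scaledZ k x * scaledZbar k x) := by
      rcases m with _ | m
      · simp [cylWave]
      · rfl
    ext v
    rw [e1, e3, ← hr]
    simp [cylWave]
    ring

theorem analyticAt_cylWave (k : ℝ) (n : ℤ) (x : Plane) : AnalyticAt ℝ (cylWave k n) x := by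
  have hz : AnalyticAt ℝ (fun x => scaledZ k x) x := (scaledZ k).analyticAt x
  have hzb : AnalyticAt ℝ (fun x => scaledZbar k x) x := (scaledZbar k).analyticAt x
  have hh : ∀ m, AnalyticAt ℝ (fun x => besselEntire m (scaledZ k x * scaledZbar k x)) x :=
    fun m => ((analyticAt_besselEntire m _).restrictScalars (𝕜 := ℝ)).fun_comp (hz.mul hzb)
  rcases n with m | m
  · exact (hz.pow m).mul (hh m)
  · exact (hzb.neg.pow (m + 1)).mul (hh (m + 1))

theorem cylWave_zero_right (k : ℝ) (n : ℤ) : cylWave k n 0 = if n = 0 then 1 else 0 := by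
  have h0 : besselEntire 0 0 = 1 := by
    rw [besselEntire, tsum_eq_single 0 (by intro p hp; simp [hp])]
    simp [besselCoeff]
  rcases n with (_ | m) | m
  · simp [cylWave, h0]
  · rw [if_neg (by simp; omega)]
    simp [cylWave]
  · simp [cylWave]

theorem ofReal_besselJ_natCast (m : ℕ) (t : ℝ) :
    (besselJ m t : ℂ) = (t / 2 : ℂ) ^ m * besselEntire m ((t / 2) ^ 2) := by
  rw [besselJ, if_pos (by positivity), one_mul, Int.natAbs_natCast, Complex.ofReal_tsum,
    besselEntire, ← tsum_mul_left]
  refine tsum_congr fun p => ?_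
  rw [besselCoeff, pow_add, pow_mul]
  push_cast
  ring

theorem besselJ_negSucc (m : ℕ) (t : ℝ) :
    besselJ (Int.negSucc m) t = (-1) ^ (m + 1) * besselJ ((m + 1 : ℕ) : ℤ) t := by
  rw [besselJ, besselJ, if_neg (by simp), if_pos (by positivity), Int.natAbs_natCast,
    Int.natAbs_negSucc, one_mul]

/-- `cylWave k n` is `J_n(kr) e^{inθ}` in polar coordinates. -/
theorem cylWave_eq (k : ℝ) (n : ℤ) (x : Plane) :
    cylWave k n x =
      (besselJ n (k * ‖x‖) : ℂ) * Complex.exp (Complex.I * (n : ℂ) * (polarAngle x : ℂ)) := by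
  have hz : (⟨x 0, x 1⟩ : ℂ) = x 0 + Complex.I * x 1 := by
    apply Complex.ext <;> simp
  have hn : ‖(⟨x 0, x 1⟩ : ℂ)‖ = ‖x‖ := by
    rw [EuclideanSpace.norm_eq, Complex.norm_def, Complex.normSq_mk, Fin.sum_univ_two]
    simp [sq]
  have hpol : (‖x‖ : ℂ) * Complex.exp (polarAngle x * Complex.I) = x 0 + Complex.I * x 1 := by
    rw [← hz, ← hn]
    exact Complex.norm_mul_exp_arg_mul_I _
  have hpol' : (‖x‖ : ℂ) * Complex.exp (-(polarAngle x * Complex.I)) = x 0 - Complex.I * x 1 := by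
    have := congrArg (starRingEnd ℂ) hpol
    simpa [← Complex.exp_conj, sub_eq_add_neg] using this
  have hzz : scaledZ k x * scaledZbar k x = (((k * ‖x‖ : ℝ) : ℂ) / 2) ^ 2 := by
    rw [scaledZ_apply, scaledZbar_apply, ← hpol, ← hpol', Complex.exp_neg]
    field_simp [Complex.exp_ne_zero]
    push_cast
    ring
  rcases n with m | m
  · rw [Int.ofNat_eq_natCast, ofReal_besselJ_natCast, ← hzz,
      show Complex.I * ((m : ℤ) : ℂ) * (polarAngle x : ℂ) = m * (polarAngle x * Complex.I) by
        push_cast; ring, Complex.exp_nat_mul]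
    change scaledZ k x ^ m * _ = _
    rw [scaledZ_apply, ← hpol]
    push_cast
    ring
  · rw [besselJ_negSucc, Complex.ofReal_mul, ofReal_besselJ_natCast, ← hzz,
      show Complex.I * ((Int.negSucc m : ℤ) : ℂ) * (polarAngle x : ℂ)
        = ((m + 1 : ℕ) : ℂ) * (-(polarAngle x * Complex.I)) by
        rw [Int.cast_negSucc]; push_cast; ring, Complex.exp_nat_mul]
    change (-scaledZbar k x) ^ (m + 1) * _ = _
    rw [scaledZbar_apply, ← hpol', neg_pow]
    push_cast
    ring

/-! ### The divergence theorem -/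

/-- The divergence of a vector field: the trace of its derivative. -/
noncomputable def divergence (G : Plane → Plane) (x : Plane) : ℝ :=
  LinearMap.trace ℝ Plane (fderiv ℝ G x : Plane →ₗ[ℝ] Plane)

theorem trace_plane (T : Plane →ₗ[ℝ] Plane) : LinearMap.trace ℝ Plane T =
    T (EuclideanSpace.single 0 1) 0 + T (EuclideanSpace.single 1 1) 1 := by
  rw [LinearMap.trace_eq_sum_inner T (EuclideanSpace.basisFun (Fin 2) ℝ)]
  simp [Fin.sum_univ_two, EuclideanSpace.inner_single_left]

theorem continuous_divergence {G : Plane → Plane} (hG : ContDiff ℝ 1 G) :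
    Continuous (divergence G) := by
  have : divergence G = fun y => fderiv ℝ G y (EuclideanSpace.single 0 1) 0 +
      fderiv ℝ G y (EuclideanSpace.single 1 1) 1 := by
    funext y
    simp [divergence, trace_plane]
  rw [this]
  have h := fun v : Plane =>
    (hG.continuous_fderiv one_ne_zero).clm_apply (continuous_const (y := v))
  have h0 := h (EuclideanSpace.single 0 1)
  have h1 := h (EuclideanSpace.single 1 1)
  fun_prop

theorem support_divergence_subset (G : Plane → Plane) :
    Function.support (divergence G) ⊆ tsupport G := fun y hy => by
  refine support_fderiv_subset ℝ (f := G) ?_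
  intro h
  exact hy (by simp [divergence, h])

theorem integrable_divergence {G : Plane → Plane} (hG : ContDiff ℝ 1 G)
    (hc : HasCompactSupport G) : Integrable (divergence G) :=
  (continuous_divergence hG).integrable_of_hasCompactSupport
    (HasCompactSupport.of_support_subset_isCompact hc.isCompact (support_divergence_subset G))

/-- The point with coordinates `(a, b)`, as a continuous linear function of `(a, b)`. -/
noncomputable def pairPlane : (ℝ × ℝ) →L[ℝ] Plane :=
  (ContinuousLinearMap.fst ℝ ℝ ℝ).smulRight (EuclideanSpace.single 0 1) +
    (ContinuousLinearMap.snd ℝ ℝ ℝ).smulRight (EuclideanSpace.single 1 1)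

theorem pairPlane_apply (p : ℝ × ℝ) : pairPlane p = !₂[p.1, p.2] := by
  ext i
  fin_cases i <;> simp [pairPlane]

theorem pairPlane_one (p : ℝ × ℝ) : pairPlane p 1 = p.2 := by simp [pairPlane_apply]

theorem pairPlane_coords (y : Plane) : pairPlane (y 0, y 1) = y := by
  ext i
  fin_cases i <;> simp [pairPlane_apply]

theorem measurePreserving_coords :
    MeasurePreserving (fun y : Plane => (y 0, y 1)) volume (volume : Measure (ℝ × ℝ)) :=
  (volume_preserving_finTwoArrow ℝ).comp
    (EuclideanSpace.volume_preserving_symm_measurableEquiv_toLp (Fin 2))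

theorem measurableEmbedding_coords :
    MeasurableEmbedding (fun y : Plane => (y 0, y 1)) :=
  (MeasurableEquiv.finTwoArrow (α := ℝ)).measurableEmbedding.comp
    (MeasurableEquiv.toLp 2 (Fin 2 → ℝ)).symm.measurableEmbedding

theorem integral_coords (f : Plane → ℝ) : ∫ y, f y = ∫ p : ℝ × ℝ, f (pairPlane p) := by
  rw [← measurePreserving_coords.integral_comp measurableEmbedding_coords]
  simp only [pairPlane_coords]

/-- A continuous compactly supported function on the plane, shifted vertically so that the graph
of `γ` becomes the horizontal axis, is again compactly supported. -/
theorem hasCompactSupport_shear {E : Type*} [NormedAddCommGroup E] {f : Plane → E}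
    (hf : HasCompactSupport f)
    {γ : ℝ → ℝ} (hγ : Continuous γ) :
    HasCompactSupport fun p : ℝ × ℝ => f (pairPlane (p.1, γ p.1 + p.2)) := by
  refine HasCompactSupport.of_support_subset_isCompact
    (K := (fun y : Plane => (y 0, y 1 - γ (y 0))) '' tsupport f)
    (hf.isCompact.image (by fun_prop)) fun p hp => ?_
  exact ⟨_, subset_tsupport _ hp, by simp [pairPlane_apply]⟩

/-- The divergence theorem for a compactly supported field on the region above a graph. The right
hand side is the flux in the direction `(γ', -1)`. -/
theorem integral_divergence_epigraph {H : Plane → Plane} (hH : ContDiff ℝ 1 H)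
    (hc : HasCompactSupport H) {γ : ℝ → ℝ} (hγ : ContDiff ℝ 1 γ) :
    ∫ y in {y : Plane | γ (y 0) < y 1}, divergence H y
      = ∫ a : ℝ, (deriv γ a * H (pairPlane (a, γ a)) 0 - H (pairPlane (a, γ a)) 1) := by
  have hγc : Continuous γ := hγ.continuous
  have hγd : Continuous (deriv γ) := hγ.continuous_deriv le_rfl
  have hHc : Continuous H := hH.continuous
  have hH' : Continuous (fderiv ℝ H) := hH.continuous_fderiv one_ne_zero
  have hc' : HasCompactSupport (fderiv ℝ H) := hc.fderiv (𝕜 := ℝ)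
  have hHd : ∀ y, HasFDerivAt H (fderiv ℝ H y) y := fun y =>
    (hH.differentiable one_ne_zero y).hasFDerivAt
  set P : ℝ × ℝ → Plane := fun p => pairPlane (p.1, γ p.1 + p.2) with hP
  have hPc : Continuous P := by fun_prop
  -- After straightening the graph, the divergence is a sum of two exact derivatives.
  set f₀ : ℝ × ℝ → ℝ := fun p =>
    fderiv ℝ H (P p) (pairPlane (1, deriv γ p.1)) 0 with hf₀
  set f₁ : ℝ × ℝ → ℝ := fun p =>
    fderiv ℝ H (P p) (pairPlane (0, 1)) 1 - deriv γ p.1 * fderiv ℝ H (P p) (pairPlane (0, 1)) 0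
    with hf₁
  have hdiv : ∀ p, divergence H (P p) = f₀ p + f₁ p := by
    intro p
    rw [divergence, trace_plane, hf₀, hf₁]
    have h1 : pairPlane (1, deriv γ p.1) =
        EuclideanSpace.single 0 1 + deriv γ p.1 • EuclideanSpace.single 1 1 := by
      simp [pairPlane]
    have h2 : pairPlane (0, 1) = EuclideanSpace.single 1 1 := by simp [pairPlane]
    simp only [h1, h2, map_add, map_smul]
    simp
  have hPs : HasCompactSupport fun p => fderiv ℝ H (P p) := hasCompactSupport_shear hc' hγc
  have hf₀c : Continuous f₀ := by
    have : Continuous fun p => fderiv ℝ H (P p) (pairPlane (1, deriv γ p.1)) :=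
      (hH'.comp hPc).clm_apply (by fun_prop)
    fun_prop
  have hf₁c : Continuous f₁ := by
    have : Continuous fun p => fderiv ℝ H (P p) (pairPlane (0, 1)) :=
      (hH'.comp hPc).clm_apply (by fun_prop)
    fun_prop
  have hf₀s : HasCompactSupport f₀ := hPs.mono fun p hp h => hp (by simp [hf₀, h])
  have hf₁s : HasCompactSupport f₁ := hPs.mono fun p hp h => hp (by simp [hf₁, h])
  have hi₀ : Integrable f₀ := hf₀c.integrable_of_hasCompactSupport hf₀s
  have hder : ∀ p : ℝ × ℝ, HasDerivAt (fun a => H (P (a, p.2)))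
      (fderiv ℝ H (P p) (pairPlane (1, deriv γ p.1))) p.1 := by
    intro p
    have h1 : HasDerivAt (fun a : ℝ => (a, γ a + p.2)) (1, deriv γ p.1) p.1 :=
      (hasDerivAt_id p.1).prodMk
        (((hγ.differentiable one_ne_zero p.1).hasDerivAt).add_const _)
    have h2 : HasDerivAt (fun a : ℝ => pairPlane (a, γ a + p.2))
        (pairPlane (1, deriv γ p.1)) p.1 :=
      (pairPlane.hasFDerivAt).comp_hasDerivAt p.1 h1
    exact (hHd _).comp_hasDerivAt p.1 h2
  have hders : ∀ p : ℝ × ℝ, HasDerivAt (fun s => H (P (p.1, s)))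
      (fderiv ℝ H (P p) (pairPlane (0, 1))) p.2 := by
    intro p
    have h1 : HasDerivAt (fun s : ℝ => (p.1, γ p.1 + s)) (0, 1) p.2 :=
      (hasDerivAt_const p.2 p.1).prodMk ((hasDerivAt_id p.2).const_add _)
    have h2 : HasDerivAt (fun s : ℝ => pairPlane (p.1, γ p.1 + s)) (pairPlane (0, 1)) p.2 :=
      (pairPlane.hasFDerivAt).comp_hasDerivAt p.2 h1
    exact (hHd _).comp_hasDerivAt p.2 h2
  have hcoord : ∀ (g : ℝ → Plane) (g' : Plane) (t : ℝ) (i : Fin 2), HasDerivAt g g' t →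
      HasDerivAt (fun t => g t i) (g' i) t := fun g g' t i h =>
    (EuclideanSpace.proj (𝕜 := ℝ) i).hasFDerivAt.comp_hasDerivAt t h
  have hHPs : HasCompactSupport fun p => H (P p) := hasCompactSupport_shear hc hγc
  have hHPc : Continuous fun p => H (P p) := hHc.comp hPc
  have secL : ∀ {E : Type} [NormedAddCommGroup E] {f : ℝ × ℝ → E} (_ : HasCompactSupport f) (s : ℝ),
      HasCompactSupport fun a => f (a, s) := by
    intro E _ f hf s
    refine HasCompactSupport.of_support_subset_isCompact (K := Prod.fst '' tsupport f)
      (hf.isCompact.image continuous_fst) fun a ha => ⟨(a, s), subset_tsupport _ ha, rfl⟩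
  have secR : ∀ {E : Type} [NormedAddCommGroup E] {f : ℝ × ℝ → E} (_ : HasCompactSupport f) (a : ℝ),
      HasCompactSupport fun s => f (a, s) := by
    intro E _ f hf a
    refine HasCompactSupport.of_support_subset_isCompact (K := Prod.snd '' tsupport f)
      (hf.isCompact.image continuous_snd) fun s hs => ⟨(a, s), subset_tsupport _ hs, rfl⟩
  have hio : Integrable f₀ ((volume : Measure ℝ).prod (volume.restrict (Set.Ioi (0 : ℝ)))) := by
    refine hi₀.mono_measure ?_
    conv_rhs => rw [Measure.volume_eq_prod]
    exact Measure.prod_mono le_rfl Measure.restrict_le_self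
  -- `f₀` is an exact derivative along the abscissa, so it is integrated in that variable first.
  have hI₀ : ∫ a : ℝ, ∫ s in Set.Ioi (0 : ℝ), f₀ (a, s) = 0 := by
    rw [integral_integral_swap (f := fun a s => f₀ (a, s)) hio]
    rw [show (fun s => ∫ a : ℝ, f₀ (a, s)) = fun _ => (0 : ℝ) from ?_]
    · simp
    funext s
    refine integral_eq_zero_of_hasDerivAt_of_integrable (f := fun a => H (P (a, s)) 0)
      (fun a => hcoord _ _ _ 0 (hder (a, s))) ?_ ?_
    · exact (by fun_prop : Continuous fun a => f₀ (a, s)).integrable_of_hasCompactSupport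
        (secL hf₀s s)
    · refine Continuous.integrable_of_hasCompactSupport (by fun_prop) ?_
      exact (secL hHPs s).mono fun a ha h => ha (by simp [h])
  have hI₁ : ∀ a : ℝ, ∫ s in Set.Ioi (0 : ℝ), f₁ (a, s) =
      deriv γ a * H (pairPlane (a, γ a)) 0 - H (pairPlane (a, γ a)) 1 := by
    intro a
    have hd : ∀ s, HasDerivAt (fun s => H (P (a, s)) 1 - deriv γ a * H (P (a, s)) 0)
        (f₁ (a, s)) s := fun s =>
      (hcoord _ _ _ 1 (hders (a, s))).sub ((hcoord _ _ _ 0 (hders (a, s))).const_mul _)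
    have hcs : HasCompactSupport fun s => H (P (a, s)) 1 - deriv γ a * H (P (a, s)) 0 :=
      (secR hHPs a).mono fun s hs h => hs (by simp [h])
    rw [integral_Ioi_of_hasDerivAt_of_tendsto (m := 0) (hd 0).continuousAt.continuousWithinAt
      (fun s _ => hd s) ?_ ?_]
    · simp [hP]
    · exact ((by fun_prop : Continuous fun s => f₁ (a, s)).integrable_of_hasCompactSupport
        (secR hf₁s a)).integrableOn
    · have := hcs.is_zero_at_infty
      exact this.mono_left atTop_le_cocompact
  have hopen : IsOpen {y : Plane | γ (y 0) < y 1} := isOpen_lt (by fun_prop) (by fun_prop)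
  have hdi : Integrable (divergence H) := integrable_divergence hH hc
  rw [← integral_indicator hopen.measurableSet, integral_coords]
  have hint : Integrable fun p : ℝ × ℝ =>
      ({y : Plane | γ (y 0) < y 1}.indicator (divergence H)) (pairPlane p) := by
    rw [← measurePreserving_coords.integrable_comp_emb measurableEmbedding_coords]
    simpa only [Function.comp_def, pairPlane_coords] using hdi.indicator hopen.measurableSet
  rw [Measure.volume_eq_prod] at hint ⊢
  rw [integral_prod _ hint]
  have hshift : ∀ a : ℝ, ∫ b : ℝ, ({y : Plane | γ (y 0) < y 1}.indicator (divergence H))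
      (pairPlane (a, b)) = (∫ s in Set.Ioi (0 : ℝ), f₀ (a, s)) +
        ∫ s in Set.Ioi (0 : ℝ), f₁ (a, s) := by
    intro a
    rw [← integral_add_left_eq_self _ (γ a), ← integral_add, ← integral_indicator measurableSet_Ioi]
    · refine integral_congr_ae (.of_forall fun s => ?_)
      by_cases hs : 0 < s
      · have h1 : pairPlane (a, γ a + s) ∈ {y : Plane | γ (y 0) < y 1} := by
          simp [pairPlane_apply, hs]
        simp only [Set.indicator_of_mem h1, Set.indicator_of_mem (show s ∈ Set.Ioi (0 : ℝ) from hs)]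
        exact hdiv (a, s)
      · have h1 : pairPlane (a, γ a + s) ∉ {y : Plane | γ (y 0) < y 1} := by
          simpa [pairPlane_apply] using hs
        simp only [Set.indicator_of_notMem h1,
          Set.indicator_of_notMem (show s ∉ Set.Ioi (0 : ℝ) from hs)]
    · exact ((by fun_prop : Continuous fun s => f₀ (a, s)).integrable_of_hasCompactSupport
        (secR hf₀s a)).integrableOn
    · exact ((by fun_prop : Continuous fun s => f₁ (a, s)).integrable_of_hasCompactSupport
        (secR hf₁s a)).integrableOn
  simp_rw [hshift, hI₁]
  rw [integral_add, hI₀, zero_add]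
  · exact hio.integral_prod_left
  · refine Continuous.integrable_of_hasCompactSupport (by fun_prop) ?_
    have := secL hHPs 0
    refine this.mono fun a ha h => ha ?_
    have h' : H (pairPlane (a, γ a)) = 0 := by simpa [hP] using h
    simp [h']

/-! ### Local geometry of the boundary -/

namespace IsLocalGraph

variable {D : Set Plane} {x : Plane} {r : ℝ} {γ : ℝ → ℝ} {e : Plane ≃ₗᵢ[ℝ] Plane}

theorem mem_iff (h : IsLocalGraph D x r γ e) {y : Plane} (hy : y ∈ Metric.ball x r) :
    y ∈ D ↔ γ (e y 0) < e y 1 := by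
  have := Set.ext_iff.1 h y
  simp only [Set.mem_inter_iff, Set.mem_ofPred_eq, hy, and_true, true_and] at this
  exact this

theorem mono (h : IsLocalGraph D x r γ e) {y : Plane} {s : ℝ}
    (hs : Metric.ball y s ⊆ Metric.ball x r) : IsLocalGraph D y s γ e := by
  ext z
  simp only [Set.mem_inter_iff, Set.mem_ofPred_eq]
  exact ⟨fun hz => ⟨hz.2, (h.mem_iff (hs hz.2)).1 hz.1⟩,
    fun hz => ⟨(h.mem_iff (hs hz.1)).2 hz.2, hz.1⟩⟩

theorem mem_frontier_iff (h : IsLocalGraph D x r γ e) (hD : IsOpen D) (hγ : Continuous γ)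
    {y : Plane} (hy : y ∈ Metric.ball x r) : y ∈ frontier D ↔ e y 1 = γ (e y 0) := by
  rw [hD.frontier_eq, Set.mem_sdiff, h.mem_iff hy]
  constructor
  · rintro ⟨hc, hn⟩
    refine le_antisymm (not_lt.1 hn) ?_
    by_contra! hlt
    have hopen : IsOpen {z : Plane | e z 1 < γ (e z 0)} := isOpen_lt (by fun_prop) (by fun_prop)
    obtain ⟨z, ⟨hz1, hz2⟩, hzD⟩ :=
      mem_closure_iff.1 hc _ (Metric.isOpen_ball.inter hopen) ⟨hy, hlt⟩
    exact lt_asymm hz2 ((h.mem_iff hz1).1 hzD)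
  · intro heq
    refine ⟨?_, by rw [heq]; exact lt_irrefl _⟩
    -- approach `y` from above the graph
    set w : ℝ → Plane := fun t => y + t • e.symm (EuclideanSpace.single 1 1) with hw
    have hwt : Tendsto w (𝓝[>] 0) (𝓝 y) := by
      have hc : Continuous w := by fun_prop
      have := hc.tendsto 0
      simp only [hw, zero_smul, add_zero] at this
      exact this.mono_left nhdsWithin_le_nhds
    refine mem_closure_of_tendsto hwt ?_
    filter_upwards [hwt.eventually (Metric.isOpen_ball.mem_nhds hy), self_mem_nhdsWithin]
      with t ht htp
    have htp : 0 < t := htp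
    rw [h.mem_iff ht]
    simpa [hw, heq] using htp

/-- The outward normal along a local graph, in terms of the slope of the graph. -/
theorem outwardNormal_eq (h : IsLocalGraph D x r γ e) (hD : IsOpen D) (hγ : Differentiable ℝ γ)
    {y : Plane} (hy : y ∈ Metric.ball x r) (hyf : y ∈ frontier D) :
    outwardNormal D y =
      e.symm ((Real.sqrt (1 + deriv γ (e y 0) ^ 2))⁻¹ • !₂[deriv γ (e y 0), -1]) := by
  obtain ⟨s, hs, hsub⟩ := Metric.isOpen_iff.1 Metric.isOpen_ball y hy
  have hn := (h.mono hsub).isOutwardUnitNormal hD hyf hs hγ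
  have hex : ∃ n, IsOutwardUnitNormal D y n := ⟨_, hn⟩
  rw [outwardNormal, dif_pos hex]
  exact hex.choose_spec.unique hn

end IsLocalGraph

/-- The graph of `γ`, parametrised by the abscissa, in the original coordinates. -/
noncomputable def graphPoint (γ : ℝ → ℝ) (e : Plane ≃ₗᵢ[ℝ] Plane) (a : ℝ) : Plane :=
  e.symm (pairPlane (a, γ a))

theorem graphPoint_coord_zero (γ : ℝ → ℝ) (e : Plane ≃ₗᵢ[ℝ] Plane) (a : ℝ) :
    e (graphPoint γ e a) 0 = a := by simp [graphPoint, pairPlane_apply]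

theorem graphPoint_coord_one (γ : ℝ → ℝ) (e : Plane ≃ₗᵢ[ℝ] Plane) (a : ℝ) :
    e (graphPoint γ e a) 1 = γ a := by simp [graphPoint, pairPlane_apply]

theorem graphPoint_eq {γ : ℝ → ℝ} {e : Plane ≃ₗᵢ[ℝ] Plane} {y : Plane}
    (h : e y 1 = γ (e y 0)) : graphPoint γ e (e y 0) = y := by
  rw [graphPoint, ← h, pairPlane_coords, e.symm_apply_apply]

theorem continuous_graphPoint {γ : ℝ → ℝ} (hγ : Continuous γ) (e : Plane ≃ₗᵢ[ℝ] Plane) :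
    Continuous (graphPoint γ e) := by
  unfold graphPoint
  fun_prop

/-- The flux density of `G` through the graph of `γ`, with respect to the abscissa: the inner
product with `(γ', -1)` in the rotated coordinates. -/
noncomputable def graphFlux (γ : ℝ → ℝ) (e : Plane ≃ₗᵢ[ℝ] Plane) (G : Plane → Plane) (a : ℝ) : ℝ :=
  deriv γ a * e (G (graphPoint γ e a)) 0 - e (G (graphPoint γ e a)) 1

theorem IsLocalGraph.graphFlux_eq {D : Set Plane} {x : Plane} {r : ℝ} {γ : ℝ → ℝ}
    {e : Plane ≃ₗᵢ[ℝ] Plane} (h : IsLocalGraph D x r γ e) (hD : IsOpen D)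
    (hγ : Differentiable ℝ γ) (G : Plane → Plane) {a : ℝ}
    (ha : graphPoint γ e a ∈ Metric.ball x r) :
    graphFlux γ e G a = Real.sqrt (1 + deriv γ a ^ 2) *
      inner ℝ (G (graphPoint γ e a)) (outwardNormal D (graphPoint γ e a)) := by
  have hf : graphPoint γ e a ∈ frontier D := by
    rw [h.mem_frontier_iff hD hγ.continuous ha, graphPoint_coord_zero, graphPoint_coord_one]
  have hs : 0 < Real.sqrt (1 + deriv γ a ^ 2) := Real.sqrt_pos.2 (by positivity)
  rw [h.outwardNormal_eq hD hγ ha hf, graphPoint_coord_zero, ← e.inner_map_map,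
    e.apply_symm_apply, inner_smul_right, mul_inv_cancel_left₀ hs.ne']
  simp [PiLp.inner_apply, Fin.sum_univ_two, graphFlux]
  ring

/-! ### The sign of the total flux through the boundary -/

theorem divergence_conj {G : Plane → Plane} (hG : Differentiable ℝ G) (e : Plane ≃ₗᵢ[ℝ] Plane)
    (y : Plane) : divergence (fun z => e (G (e.symm z))) y = divergence G (e.symm y) := by
  have h : HasFDerivAt (fun z => e (G (e.symm z)))
      ((e.toContinuousLinearEquiv : Plane →L[ℝ] Plane).comp ((fderiv ℝ G (e.symm y)).comp
        (e.symm.toContinuousLinearEquiv : Plane →L[ℝ] Plane))) y :=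
    (e.toContinuousLinearEquiv.hasFDerivAt).comp y
      (((hG _).hasFDerivAt).comp y e.symm.toContinuousLinearEquiv.hasFDerivAt)
  rw [divergence, h.fderiv, divergence,
    ← LinearMap.trace_conj' (fderiv ℝ G (e.symm y) : Plane →ₗ[ℝ] Plane) e.toLinearEquiv]
  rfl

/-- The divergence theorem for a field supported in a ball where the boundary is a graph. -/
theorem IsLocalGraph.setIntegral_divergence {D : Set Plane} {x : Plane} {r : ℝ} {γ : ℝ → ℝ}
    {e : Plane ≃ₗᵢ[ℝ] Plane} (h : IsLocalGraph D x r γ e) (hD : IsOpen D) (hγ : ContDiff ℝ 1 γ)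
    {G : Plane → Plane} (hG : ContDiff ℝ 1 G) (hs : tsupport G ⊆ Metric.ball x r)
    (hc : HasCompactSupport G) :
    ∫ y in D, divergence G y = ∫ a, graphFlux γ e G a := by
  have hγc : Continuous γ := hγ.continuous
  have hopen : IsOpen {y : Plane | γ (e y 0) < e y 1} := isOpen_lt (by fun_prop) (by fun_prop)
  have h1 : ∫ y in D, divergence G y = ∫ y in {y : Plane | γ (e y 0) < e y 1}, divergence G y := by
    rw [← integral_indicator hD.measurableSet, ← integral_indicator hopen.measurableSet]
    congr 1
    funext y
    by_cases hy : y ∈ Metric.ball x r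
    · by_cases hyD : y ∈ D
      · rw [Set.indicator_of_mem hyD, Set.indicator_of_mem]
        exact (h.mem_iff hy).1 hyD
      · rw [Set.indicator_of_notMem hyD, Set.indicator_of_notMem]
        exact fun h' => hyD ((h.mem_iff hy).2 h')
    · have : divergence G y = 0 := by
        by_contra h0
        exact hy (hs (support_divergence_subset G h0))
      simp [Set.indicator_apply, this]
  set H : Plane → Plane := fun z => e (G (e.symm z)) with hH
  have hHc : ContDiff ℝ 1 H :=
    e.toContinuousLinearEquiv.contDiff.comp (hG.comp e.symm.toContinuousLinearEquiv.contDiff)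
  have hHs : HasCompactSupport H :=
    (hc.comp_homeomorph e.symm.toHomeomorph).comp_left (g := e) (map_zero e)
  have h2 := integral_divergence_epigraph hHc hHs hγ
  rw [h1]
  have h3 := e.measurePreserving.setIntegral_preimage_emb
    e.toHomeomorph.measurableEmbedding (divergence H) {y : Plane | γ (y 0) < y 1}
  rw [h2] at h3
  rw [show (∫ a, graphFlux γ e G a) = _ from h3.symm]
  refine integral_congr_ae (.of_forall fun y => ?_)
  change divergence G y = divergence H (e y)
  rw [hH, divergence_conj (hG.differentiable one_ne_zero), e.symm_apply_apply]

/-- The integral of the divergence of a compactly supported field vanishes. -/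
theorem integral_divergence_eq_zero {G : Plane → Plane} (hG : ContDiff ℝ 1 G)
    (hc : HasCompactSupport G) : ∫ y, divergence G y = 0 := by
  -- apply the epigraph theorem to a half plane containing the support
  obtain ⟨R, hR⟩ := hc.isCompact.isBounded.subset_closedBall (0 : Plane)
  have hG0 : ∀ y : Plane, y 1 ≤ -(|R| + 1) → y ∉ tsupport G := by
    intro y hy hyt
    have h1 := mem_closedBall_zero_iff.1 (hR hyt)
    have h2 : |y 1| ≤ ‖y‖ := PiLp.norm_apply_le y 1
    have h3 := neg_le_abs (y 1)
    have h4 := le_abs_self R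
    linarith
  have h := integral_divergence_epigraph hG hc (γ := fun _ => -(|R| + 1)) contDiff_const
  rw [setIntegral_eq_integral_of_forall_compl_eq_zero] at h
  · rw [h]
    refine integral_eq_zero_of_ae (.of_forall fun a => ?_)
    have : G (pairPlane (a, -(|R| + 1))) = 0 := by
      by_contra h0
      exact hG0 _ (by rw [pairPlane_one]) (subset_tsupport _ h0)
    simp only [this, PiLp.zero_apply, mul_zero, sub_zero, Pi.zero_apply]
  · intro y hy
    by_contra h0
    exact hG0 y (not_lt.1 hy) (support_divergence_subset G h0)

/-- A ball on which the boundary of `D` is understood: it lies in `D`, or `D` is the region above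
a graph there. -/
def IsGoodBall (D : Set Plane) (x : Plane) (r : ℝ) : Prop :=
  Metric.ball x r ⊆ D ∨ ∃ γ : ℝ → ℝ, ContDiff ℝ ∞ γ ∧
    ∃ e : Plane ≃ₗᵢ[ℝ] Plane, IsLocalGraph D x r γ e

theorem IsGoodBall.setIntegral_divergence_smul_nonneg {D : Set Plane} (hD : IsOpen D) {x : Plane}
    {r : ℝ} (h : IsGoodBall D x r) {G : Plane → Plane} (hG : ContDiff ℝ 1 G)
    (hpos : ∀ y ∈ frontier D, 0 ≤ inner ℝ (G y) (outwardNormal D y))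
    {χ : Plane → ℝ} (hχ : ContDiff ℝ 1 χ) (hχ0 : ∀ y, 0 ≤ χ y)
    (hs : tsupport χ ⊆ Metric.ball x r) :
    0 ≤ ∫ y in D, divergence (fun y => χ y • G y) y ∧
      ∀ p ∈ frontier D, 0 < χ p → 0 < inner ℝ (G p) (outwardNormal D p) →
        0 < ∫ y in D, divergence (fun y => χ y • G y) y := by
  have hsub : tsupport (fun y => χ y • G y) ⊆ tsupport χ := tsupport_smul_subset_left χ G
  have hcχ : HasCompactSupport χ :=
    Metric.isCompact_of_isClosed_isBounded (isClosed_tsupport _) (Metric.isBounded_ball.subset hs)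
  have hc : HasCompactSupport (fun y => χ y • G y) := hcχ.smul_right
  have hχG : ContDiff ℝ 1 (fun y => χ y • G y) := hχ.smul hG
  rcases h with h | ⟨γ, hγ, e, h⟩
  · have h0 : ∫ y in D, divergence (fun y => χ y • G y) y = 0 := by
      rw [setIntegral_eq_integral_of_forall_compl_eq_zero, integral_divergence_eq_zero hχG hc]
      intro y hy
      by_contra h0
      exact hy (h (hs (hsub (support_divergence_subset _ h0))))
    refine ⟨h0.ge, fun p hp hp0 _ => ?_⟩
    rw [hD.frontier_eq] at hp
    exact absurd (h (hs (subset_tsupport _ hp0.ne'))) hp.2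
  · have hγ1 : ContDiff ℝ 1 γ := hγ.of_le (by simp)
    have hγd := hγ1.differentiable one_ne_zero
    rw [h.setIntegral_divergence hD hγ1 hχG (hsub.trans hs) hc]
    have hval : ∀ a, graphFlux γ e (fun y => χ y • G y) a =
        χ (graphPoint γ e a) * graphFlux γ e G a := by
      intro a
      simp [graphFlux]
      ring
    have hnn : ∀ a, 0 ≤ graphFlux γ e (fun y => χ y • G y) a := by
      intro a
      rw [hval]
      by_cases ha : graphPoint γ e a ∈ Metric.ball x r
      · rw [h.graphFlux_eq hD hγd G ha]
        have hf : graphPoint γ e a ∈ frontier D := by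
          rw [h.mem_frontier_iff hD hγd.continuous ha, graphPoint_coord_zero, graphPoint_coord_one]
        exact mul_nonneg (hχ0 _) (mul_nonneg (Real.sqrt_nonneg _) (hpos _ hf))
      · have : χ (graphPoint γ e a) = 0 := by
          by_contra h0
          exact ha (hs (subset_tsupport _ h0))
        simp [this]
    refine ⟨integral_nonneg hnn, fun p hp hp0 hpG => ?_⟩
    have hpb := hs (subset_tsupport _ hp0.ne')
    have hpe := graphPoint_eq ((h.mem_frontier_iff hD hγd.continuous hpb).1 hp)
    have hcont : Continuous (graphFlux γ e fun y => χ y • G y) := by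
      have h1 := continuous_graphPoint hγd.continuous e
      have h2 := hγ1.continuous_deriv le_rfl
      have h3 := hχG.continuous
      unfold graphFlux
      fun_prop
    have hcs : HasCompactSupport (graphFlux γ e fun y => χ y • G y) := by
      refine HasCompactSupport.of_support_subset_isCompact
        (K := (fun y => e y 0) '' tsupport χ) (hcχ.isCompact.image (by fun_prop)) fun a ha => ?_
      refine ⟨graphPoint γ e a, subset_tsupport _ fun h0 => ha ?_, graphPoint_coord_zero _ _ _⟩
      rw [hval, h0, zero_mul]
    refine hcont.integral_pos_of_hasCompactSupport_nonneg_nonzero hcs hnn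
      (x := e p 0) ?_
    rw [hval, h.graphFlux_eq hD hγd G (by rwa [hpe]), hpe]
    have : 0 < Real.sqrt (1 + deriv γ (e p 0) ^ 2) := Real.sqrt_pos.2 (by positivity)
    positivity

/-- A consequence of the divergence theorem on `D`: a field that nowhere points into `D` along the
boundary has nonnegative total divergence, and this is positive if the field points strictly
outwards somewhere. A partition of unity reduces this to local graphs. -/
theorem IsSmoothSimplyConnectedDomain.setIntegral_divergence_nonneg {D : Set Plane}
    (hD : IsSmoothSimplyConnectedDomain D) {G : Plane → Plane} (hG : ContDiff ℝ 1 G)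
    (hpos : ∀ y ∈ frontier D, 0 ≤ inner ℝ (G y) (outwardNormal D y)) :
    0 ≤ ∫ y in D, divergence G y ∧
      ∀ p ∈ frontier D, 0 < inner ℝ (G p) (outwardNormal D p) →
        0 < ∫ y in D, divergence G y := by
  have hK : IsCompact (closure D) := hD.isBounded.isCompact_closure
  have hgood : ∀ x ∈ closure D, ∃ r, 0 < r ∧ IsGoodBall D x r := by
    intro x hx
    by_cases hxD : x ∈ D
    · obtain ⟨r, hr, hsub⟩ := Metric.isOpen_iff.1 hD.isOpen x hxD
      exact ⟨r, hr, .inl hsub⟩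
    · obtain ⟨r, hr, γ, hγ, e, h⟩ := hD.smoothBoundary x
        (by rw [hD.isOpen.frontier_eq]; exact ⟨hx, hxD⟩)
      exact ⟨r, hr, .inr ⟨γ, hγ, e, h⟩⟩
  choose! r hr hgr using hgood
  obtain ⟨t, htK, htc⟩ := hK.elim_nhds_subcover (fun x => Metric.ball x (r x))
    fun x hx => Metric.ball_mem_nhds x (hr x hx)
  obtain ⟨f, hf⟩ := SmoothPartitionOfUnity.exists_isSubordinate (modelWithCornersSelf ℝ Plane)
    isClosed_closure (fun x : t => Metric.ball (x : Plane) (r x)) (fun _ => Metric.isOpen_ball)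
    (by simpa [Set.iUnion_subtype] using htc)
  have hfs : ∀ i, ContDiff ℝ 1 (f i) := fun i => (f i).contMDiff.contDiff.of_le (by simp)
  have hsum : ∀ y ∈ closure D, ∑ i, f i y = 1 := fun y hy => by
    rw [← finsum_eq_sum_of_fintype]
    exact f.sum_eq_one hy
  have hfc : ∀ i, HasCompactSupport (f i) := fun i =>
    Metric.isCompact_of_isClosed_isBounded (isClosed_tsupport _) (Metric.isBounded_ball.subset (hf i))
  have hloc := fun i : t => (hgr i (htK i i.2)).setIntegral_divergence_smul_nonneg hD.isOpen hG hpos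
    (hfs i) (f.nonneg i) (hf i)
  have hdec : ∫ y in D, divergence G y = ∑ i, ∫ y in D, divergence (fun y => f i y • G y) y := by
    have hi : ∀ i, Integrable (fun y => divergence (fun y => f i y • G y) y) (volume.restrict D) :=
      fun i => (integrable_divergence ((hfs i).smul hG) (hfc i).smul_right).integrableOn
    rw [← integral_finsetSum _ fun i _ => hi i]
    refine setIntegral_congr_fun hD.isOpen.measurableSet fun y hy => ?_
    have hd : ∀ i ∈ Finset.univ, HasFDerivAt (fun y => f i y • G y)
        (fderiv ℝ (fun y => f i y • G y) y) y := fun i _ =>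
      (((hfs i).smul hG).differentiable one_ne_zero y).hasFDerivAt
    have heq : G =ᶠ[𝓝 y] fun y => ∑ i, f i y • G y := by
      filter_upwards [hD.isOpen.mem_nhds hy] with z hz
      rw [← Finset.sum_smul, hsum z (subset_closure hz), one_smul]
    simp only [divergence]
    rw [heq.fderiv_eq, (HasFDerivAt.fun_sum hd).fderiv, ← map_sum]
    congr 1
    ext v
    simp
  rw [hdec]
  refine ⟨Finset.sum_nonneg fun i _ => (hloc i).1, fun p hp hpG => ?_⟩
  obtain ⟨i, hi⟩ : ∃ i, 0 < f i p := by
    by_contra! h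
    have h1 := hsum p hp.1
    have h2 := Finset.sum_nonpos fun i (_ : i ∈ Finset.univ) => h i
    linarith
  exact Finset.sum_pos' (fun i _ => (hloc i).1) ⟨i, Finset.mem_univ _, (hloc i).2 p hp hi hpG⟩

/-! ### Uniqueness for the Helmholtz equation with impedance boundary condition -/

/-- The `i`-th partial derivative of a real function on the plane. -/
noncomputable def partialDeriv (i : Fin 2) (f : Plane → ℝ) (x : Plane) : ℝ :=
  fderiv ℝ f x (EuclideanSpace.single i 1)

/-- The Laplacian of a real function on the plane. -/
noncomputable def planeLaplacian (f : Plane → ℝ) (x : Plane) : ℝ :=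
  partialDeriv 0 (partialDeriv 0 f) x + partialDeriv 1 (partialDeriv 1 f) x

theorem contDiff_partialDeriv {f : Plane → ℝ} (hf : ContDiff ℝ ∞ f) (i : Fin 2) :
    ContDiff ℝ ∞ (partialDeriv i f) :=
  (hf.fderiv_right (m := ∞) (by simp)).clm_apply contDiff_const

theorem fderiv_eq_partialDeriv (f : Plane → ℝ) (x v : Plane) :
    fderiv ℝ f x v = partialDeriv 0 f x * v 0 + partialDeriv 1 f x * v 1 := by
  have hv : v = v 0 • EuclideanSpace.single 0 1 + v 1 • EuclideanSpace.single 1 1 := by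
    ext i
    fin_cases i <;> simp
  conv_lhs => rw [hv]
  simp [partialDeriv]
  ring

theorem partialDeriv_add {f g : Plane → ℝ} (hf : ContDiff ℝ ∞ f) (hg : ContDiff ℝ ∞ g)
    (i : Fin 2) (x : Plane) :
    partialDeriv i (fun x => f x + g x) x = partialDeriv i f x + partialDeriv i g x := by
  rw [partialDeriv, fderiv_fun_add (hf.differentiable (by simp) x) (hg.differentiable (by simp) x)]
  rfl

theorem partialDeriv_sub {f g : Plane → ℝ} (hf : ContDiff ℝ ∞ f) (hg : ContDiff ℝ ∞ g)
    (i : Fin 2) (x : Plane) :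
    partialDeriv i (fun x => f x - g x) x = partialDeriv i f x - partialDeriv i g x := by
  rw [partialDeriv, fderiv_fun_sub (hf.differentiable (by simp) x) (hg.differentiable (by simp) x)]
  rfl

theorem partialDeriv_mul {f g : Plane → ℝ} (hf : ContDiff ℝ ∞ f) (hg : ContDiff ℝ ∞ g)
    (i : Fin 2) (x : Plane) :
    partialDeriv i (fun x => f x * g x) x = f x * partialDeriv i g x + g x * partialDeriv i f x := by
  rw [partialDeriv, fderiv_fun_mul (hf.differentiable (by simp) x) (hg.differentiable (by simp) x)]
  rfl

theorem partialDeriv_const_mul {f : Plane → ℝ} (hf : ContDiff ℝ ∞ f) (c : ℝ)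
    (i : Fin 2) (x : Plane) :
    partialDeriv i (fun x => c * f x) x = c * partialDeriv i f x := by
  rw [partialDeriv, fderiv_const_mul (hf.differentiable (by simp) x)]
  rfl

theorem partialDeriv_coord (i j : Fin 2) (x : Plane) :
    partialDeriv i (fun x => x j) x = if i = j then 1 else 0 := by
  have h : HasFDerivAt (fun x : Plane => x j) (EuclideanSpace.proj (𝕜 := ℝ) j) x :=
    (EuclideanSpace.proj (𝕜 := ℝ) j).hasFDerivAt
  rw [partialDeriv, h.fderiv]
  simp [eq_comm]

theorem partialDeriv_comm {f : Plane → ℝ} (hf : ContDiff ℝ ∞ f) (i j : Fin 2) :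
    partialDeriv i (partialDeriv j f) = partialDeriv j (partialDeriv i f) := by
  have h : ∀ i j x, partialDeriv i (partialDeriv j f) x =
      fderiv ℝ (fderiv ℝ f) x (EuclideanSpace.single i 1) (EuclideanSpace.single j 1) := by
    intro i j x
    have hd := (hf.fderiv_right (m := ∞) (by simp)).differentiable (by simp) x
    rw [partialDeriv]
    change fderiv ℝ (fun y => fderiv ℝ f y (EuclideanSpace.single j 1)) x _ = _
    rw [fderiv_clm_apply hd (differentiableAt_const _)]
    simp
  funext x
  rw [h, h]
  exact ((contDiff_infty.1 hf 2).contDiffAt.isSymmSndFDerivAt (by simp)).eq _ _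

/-- Green's field `a ∇b - b ∇a`. -/
noncomputable def greenField (a b : Plane → ℝ) (x : Plane) : Plane :=
  pairPlane (a x * partialDeriv 0 b x - b x * partialDeriv 0 a x,
    a x * partialDeriv 1 b x - b x * partialDeriv 1 a x)

theorem contDiff_greenField {a b : Plane → ℝ} (ha : ContDiff ℝ ∞ a) (hb : ContDiff ℝ ∞ b) :
    ContDiff ℝ ∞ (greenField a b) := by
  have := contDiff_partialDeriv ha
  have := contDiff_partialDeriv hb
  exact pairPlane.contDiff.comp (by fun_prop)

theorem inner_greenField (a b : Plane → ℝ) (x v : Plane) :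
    inner ℝ (greenField a b x) v = a x * fderiv ℝ b x v - b x * fderiv ℝ a x v := by
  rw [fderiv_eq_partialDeriv, fderiv_eq_partialDeriv]
  simp [greenField, PiLp.inner_apply, Fin.sum_univ_two, pairPlane_apply]
  ring

theorem divergence_greenField {a b : Plane → ℝ} (ha : ContDiff ℝ ∞ a) (hb : ContDiff ℝ ∞ b)
    (x : Plane) :
    divergence (greenField a b) x = a x * planeLaplacian b x - b x * planeLaplacian a x := by
  have hG := (contDiff_greenField ha hb).differentiable (by simp) x
  have hi : ∀ i : Fin 2, fderiv ℝ (greenField a b) x (EuclideanSpace.single i 1) i =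
      partialDeriv i (fun x => greenField a b x i) x := by
    intro i
    have h : HasFDerivAt (fun x => greenField a b x i)
        ((EuclideanSpace.proj (𝕜 := ℝ) i).comp (fderiv ℝ (greenField a b) x)) x :=
      (EuclideanSpace.proj (𝕜 := ℝ) i).hasFDerivAt.comp x hG.hasFDerivAt
    rw [partialDeriv, h.fderiv]
    rfl
  have hpa := contDiff_partialDeriv ha
  have hpb := contDiff_partialDeriv hb
  have hc : ∀ i : Fin 2, (fun x => greenField a b x i) =
      fun x => a x * partialDeriv i b x - b x * partialDeriv i a x := by
    intro i
    fin_cases i <;> simp [greenField, pairPlane_apply]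
  rw [divergence, trace_plane]
  simp only [ContinuousLinearMap.coe_coe, hi, hc]
  rw [partialDeriv_sub (ha.mul (hpb 0)) (hb.mul (hpa 0)),
    partialDeriv_sub (ha.mul (hpb 1)) (hb.mul (hpa 1)),
    partialDeriv_mul ha (hpb 0), partialDeriv_mul hb (hpa 0),
    partialDeriv_mul ha (hpb 1), partialDeriv_mul hb (hpa 1), planeLaplacian, planeLaplacian]
  ring

/-- The radial derivative `x · ∇f`. -/
noncomputable def radialDeriv (f : Plane → ℝ) (x : Plane) : ℝ :=
  x 0 * partialDeriv 0 f x + x 1 * partialDeriv 1 f x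

theorem contDiff_coord (i : Fin 2) : ContDiff ℝ ∞ fun x : Plane => x i :=
  (EuclideanSpace.proj (𝕜 := ℝ) i).contDiff

theorem contDiff_radialDeriv {f : Plane → ℝ} (hf : ContDiff ℝ ∞ f) :
    ContDiff ℝ ∞ (radialDeriv f) :=
  ((contDiff_coord 0).mul (contDiff_partialDeriv hf 0)).add
    ((contDiff_coord 1).mul (contDiff_partialDeriv hf 1))

theorem partialDeriv_radialDeriv {f : Plane → ℝ} (hf : ContDiff ℝ ∞ f) (i : Fin 2) :
    partialDeriv i (radialDeriv f) = fun x => partialDeriv i f x + radialDeriv (partialDeriv i f) x := by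
  have hp := contDiff_partialDeriv hf
  funext x
  change partialDeriv i (fun x => x 0 * partialDeriv 0 f x + x 1 * partialDeriv 1 f x) x = _
  rw [partialDeriv_add ((contDiff_coord 0).mul (hp 0)) ((contDiff_coord 1).mul (hp 1)),
    partialDeriv_mul (contDiff_coord 0) (hp 0), partialDeriv_mul (contDiff_coord 1) (hp 1),
    partialDeriv_coord, partialDeriv_coord, radialDeriv, partialDeriv_comm hf i 0,
    partialDeriv_comm hf i 1]
  fin_cases i <;> simp <;> ring

/-- The commutator of the Laplacian and the radial derivative is twice the Laplacian. -/
theorem planeLaplacian_radialDeriv {f : Plane → ℝ} (hf : ContDiff ℝ ∞ f) (x : Plane) :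
    planeLaplacian (radialDeriv f) x =
      2 * planeLaplacian f x + radialDeriv (planeLaplacian f) x := by
  have hp := contDiff_partialDeriv hf
  have h2 : ∀ i, partialDeriv i (partialDeriv i (radialDeriv f)) x =
      2 * partialDeriv i (partialDeriv i f) x +
        radialDeriv (partialDeriv i (partialDeriv i f)) x := by
    intro i
    rw [partialDeriv_radialDeriv hf, partialDeriv_add (hp i) (contDiff_radialDeriv (hp i)),
      partialDeriv_radialDeriv (hp i)]
    ring
  have hpp := fun i => contDiff_partialDeriv (hp i) i
  have h3 : radialDeriv (planeLaplacian f) x = radialDeriv (partialDeriv 0 (partialDeriv 0 f)) x +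
      radialDeriv (partialDeriv 1 (partialDeriv 1 f)) x := by
    have h4 : ∀ i, partialDeriv i (planeLaplacian f) x =
        partialDeriv i (partialDeriv 0 (partialDeriv 0 f)) x +
          partialDeriv i (partialDeriv 1 (partialDeriv 1 f)) x :=
      fun i => partialDeriv_add (hpp 0) (hpp 1) i x
    rw [radialDeriv, h4, h4, radialDeriv, radialDeriv]
    ring
  rw [planeLaplacian, h2, h2, h3, planeLaplacian]
  ring

/-- A solution of the Helmholtz equation whose Cauchy data vanish on the boundary vanishes in `D`.
By Rellich's identity, `φ = -(x · ∇a) / (2k²)` solves `Δφ + k²φ = a`, so Green's second identity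
for `φ` and `a` reads `∫_D a² = 0`. -/
theorem IsSmoothSimplyConnectedDomain.eqOn_zero_of_cauchyData {D : Set Plane}
    (hD : IsSmoothSimplyConnectedDomain D) {k : ℝ} (hk : 0 < k) {a : Plane → ℝ}
    (ha : ContDiff ℝ ∞ a) (hla : ∀ x, planeLaplacian a x = -k ^ 2 * a x)
    (h0 : ∀ x ∈ frontier D, a x = 0)
    (h1 : ∀ x ∈ frontier D, fderiv ℝ a x (outwardNormal D x) = 0) :
    ∀ x ∈ D, a x = 0 := by
  set c : ℝ := -1 / (2 * k ^ 2) with hc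
  set φ : Plane → ℝ := fun x => c * radialDeriv a x with hφ
  have hr := contDiff_radialDeriv ha
  have hφs : ContDiff ℝ ∞ φ := contDiff_const.mul hr
  have hlφ : ∀ x, planeLaplacian φ x = -k ^ 2 * φ x + a x := by
    intro x
    have e1 : ∀ i, partialDeriv i φ = fun x => c * partialDeriv i (radialDeriv a) x := fun i =>
      funext fun x => partialDeriv_const_mul hr c i x
    have e2 : planeLaplacian φ x = c * planeLaplacian (radialDeriv a) x := by
      rw [planeLaplacian, e1, e1, partialDeriv_const_mul (contDiff_partialDeriv hr 0),
        partialDeriv_const_mul (contDiff_partialDeriv hr 1), planeLaplacian]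
      ring
    have e3 : planeLaplacian a = fun x => -k ^ 2 * a x := funext hla
    have e4 : radialDeriv (planeLaplacian a) x = -k ^ 2 * radialDeriv a x := by
      rw [radialDeriv, e3, partialDeriv_const_mul ha, partialDeriv_const_mul ha, radialDeriv]
      ring
    rw [e2, planeLaplacian_radialDeriv ha, e4, hla, hφ, hc]
    field_simp
    ring
  have hdiv : ∀ x, divergence (greenField φ a) x = -(a x ^ 2) := by
    intro x
    rw [divergence_greenField hφs ha, hla, hlφ]
    ring
  have hle := (hD.setIntegral_divergence_nonneg
    ((contDiff_greenField hφs ha).of_le (by simp)) (fun y hy => by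
      rw [inner_greenField, h0 y hy, h1 y hy]; simp)).1
  simp only [hdiv, integral_neg] at hle
  have hac : Continuous a := ha.continuous
  have hint : IntegrableOn (fun x => a x ^ 2) D :=
    ((by fun_prop : Continuous fun x => a x ^ 2).continuousOn.integrableOn_compact
      hD.isBounded.isCompact_closure).mono_set subset_closure
  have hzero : ∫ x in D, a x ^ 2 = 0 :=
    le_antisymm (by linarith) (integral_nonneg fun x => sq_nonneg _)
  have hae := (integral_eq_zero_iff_of_nonneg (fun x => sq_nonneg (a x)) hint).1 hzero
  intro x hx
  have := Measure.eqOn_open_of_ae_eq hae hD.isOpen (by fun_prop) continuousOn_const hx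
  simpa using this

/-- If `u = a + ib` solves the Helmholtz equation and `∂u/∂ν = -iku` on the boundary, then `u`
vanishes in `D`. The field `b ∇a - a ∇b` is divergence free and its outward flux density is
`k |u|²`, so the Cauchy data of `u` vanish. -/
theorem IsSmoothSimplyConnectedDomain.eqOn_zero_of_impedance {D : Set Plane}
    (hD : IsSmoothSimplyConnectedDomain D) {k : ℝ} (hk : 0 < k) {a b : Plane → ℝ}
    (ha : ContDiff ℝ ∞ a) (hb : ContDiff ℝ ∞ b)
    (hla : ∀ x, planeLaplacian a x = -k ^ 2 * a x)
    (hlb : ∀ x, planeLaplacian b x = -k ^ 2 * b x)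
    (hna : ∀ x ∈ frontier D, fderiv ℝ a x (outwardNormal D x) = k * b x)
    (hnb : ∀ x ∈ frontier D, fderiv ℝ b x (outwardNormal D x) = -k * a x) :
    ∀ x ∈ D, a x = 0 ∧ b x = 0 := by
  have hflux : ∀ y ∈ frontier D, inner ℝ (greenField b a y) (outwardNormal D y) =
      k * (a y ^ 2 + b y ^ 2) := by
    intro y hy
    rw [inner_greenField, hna y hy, hnb y hy]
    ring
  have h := hD.setIntegral_divergence_nonneg
    ((contDiff_greenField hb ha).of_le (by simp)) (fun y hy => by
      rw [hflux y hy]; positivity)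
  have hdiv : ∫ y in D, divergence (greenField b a) y = 0 := by
    refine integral_eq_zero_of_ae (.of_forall fun y => ?_)
    rw [divergence_greenField hb ha, hla, hlb, Pi.zero_apply]
    ring
  have hbd : ∀ y ∈ frontier D, a y = 0 ∧ b y = 0 := by
    intro y hy
    have hn := h.2 y hy
    rw [hdiv, hflux y hy] at hn
    have hs : a y ^ 2 + b y ^ 2 ≤ 0 := by
      by_contra! hlt
      exact lt_irrefl _ (hn (mul_pos hk hlt))
    constructor <;> nlinarith [sq_nonneg (a y), sq_nonneg (b y)]
  intro x hx
  exact ⟨hD.eqOn_zero_of_cauchyData hk ha hla (fun y hy => (hbd y hy).1)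
      (fun y hy => by rw [hna y hy, (hbd y hy).2, mul_zero]) x hx,
    hD.eqOn_zero_of_cauchyData hk hb hlb (fun y hy => (hbd y hy).2)
      (fun y hy => by rw [hnb y hy, (hbd y hy).1, mul_zero]) x hx⟩

/-! ### Arc length on the boundary -/

theorem IsSmoothSimplyConnectedDomain.isCompact_frontier {D : Set Plane}
    (hD : IsSmoothSimplyConnectedDomain D) : IsCompact (frontier D) :=
  hD.isBounded.isCompact_closure.of_isClosed_subset isClosed_frontier frontier_subset_closure

theorem IsSmoothSimplyConnectedDomain.continuousOn_outwardNormal {D : Set Plane}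
    (hD : IsSmoothSimplyConnectedDomain D) : ContinuousOn (outwardNormal D) (frontier D) := by
  intro x hx
  obtain ⟨r, hr, γ, hγ, e, h⟩ := hD.smoothBoundary x hx
  have hγd : Continuous (deriv γ) := hγ.continuous_deriv (by simp)
  set ν : Plane → Plane := fun y =>
    e.symm ((Real.sqrt (1 + deriv γ (e y 0) ^ 2))⁻¹ • pairPlane (deriv γ (e y 0), -1)) with hν
  have hs : ∀ y, Real.sqrt (1 + deriv γ (e y 0) ^ 2) ≠ 0 := fun y =>
    (Real.sqrt_pos.2 (by positivity)).ne'
  have hνc : Continuous ν := by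
    have h1 : Continuous fun y => (Real.sqrt (1 + deriv γ (e y 0) ^ 2))⁻¹ :=
      Continuous.inv₀ (by fun_prop) hs
    fun_prop
  refine (hνc.continuousWithinAt (s := frontier D) (x := x)).congr_of_eventuallyEq ?_ ?_
  · filter_upwards [self_mem_nhdsWithin,
      mem_nhdsWithin_of_mem_nhds (Metric.ball_mem_nhds x hr)] with y hy hyb
    rw [h.outwardNormal_eq hD.isOpen (hγ.differentiable (by simp)) hyb hy]
    simp only [hν, pairPlane_apply]
  · rw [h.outwardNormal_eq hD.isOpen (hγ.differentiable (by simp)) (Metric.mem_ball_self hr) hx]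
    simp only [hν, pairPlane_apply]

theorem contDiff_graphPoint {γ : ℝ → ℝ} (hγ : ContDiff ℝ 1 γ) (e : Plane ≃ₗᵢ[ℝ] Plane) :
    ContDiff ℝ 1 (graphPoint γ e) :=
  e.symm.toContinuousLinearEquiv.contDiff.comp (pairPlane.contDiff.comp (contDiff_id.prodMk hγ))

/-- The boundary has finite length. -/
theorem IsSmoothSimplyConnectedDomain.hausdorffMeasure_frontier_lt_top {D : Set Plane}
    (hD : IsSmoothSimplyConnectedDomain D) : Measure.hausdorffMeasure 1 (frontier D) < ⊤ := by
  refine hD.isCompact_frontier.measure_lt_top_of_nhdsWithin fun x hx => ?_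
  obtain ⟨r, hr, γ, hγ, e, h⟩ := hD.smoothBoundary x hx
  have hγ1 : ContDiff ℝ 1 γ := hγ.of_le (by simp)
  refine ⟨frontier D ∩ Metric.ball x r,
    inter_mem_nhdsWithin _ (Metric.ball_mem_nhds x hr), ?_⟩
  set I : Set ℝ := Metric.closedBall (e x 0) r with hI
  have hsub : frontier D ∩ Metric.ball x r ⊆ graphPoint γ e '' I := by
    rintro y ⟨hy, hyb⟩
    refine ⟨e y 0, ?_, graphPoint_eq ((h.mem_frontier_iff hD.isOpen hγ.continuous hyb).1 hy)⟩
    rw [hI, Metric.mem_closedBall, Real.dist_eq]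
    have h1 : |(e (y - x)) 0| ≤ ‖e (y - x)‖ := PiLp.norm_apply_le (e (y - x)) 0
    rw [e.norm_map, ← dist_eq_norm] at h1
    simp only [map_sub, PiLp.sub_apply] at h1
    exact h1.trans (Metric.mem_ball.1 hyb).le
  obtain ⟨K, hK⟩ := (contDiff_graphPoint hγ1 e).contDiffOn.exists_lipschitzOnWith one_ne_zero
    (convex_closedBall (e x 0) r) (isCompact_closedBall _ _)
  refine (measure_mono hsub).trans_lt ((hK.hausdorffMeasure_image_le zero_le_one).trans_lt ?_)
  rw [hausdorffMeasure_real]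
  exact ENNReal.mul_lt_top (by simp) (isCompact_closedBall _ _).measure_lt_top

/-- Every relatively open piece of the boundary has positive length: it projects onto an
interval. -/
theorem IsSmoothSimplyConnectedDomain.hausdorffMeasure_inter_frontier_pos {D : Set Plane}
    (hD : IsSmoothSimplyConnectedDomain D) {x : Plane} (hx : x ∈ frontier D) {U : Set Plane}
    (hU : U ∈ 𝓝[frontier D] x) : 0 < Measure.hausdorffMeasure 1 (U ∩ frontier D) := by
  obtain ⟨r, hr, γ, hγ, e, h⟩ := hD.smoothBoundary x hx
  have hx' := graphPoint_eq ((h.mem_frontier_iff hD.isOpen hγ.continuous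
    (Metric.mem_ball_self hr)).1 hx)
  obtain ⟨V, hV, hVU⟩ := mem_nhdsWithin_iff_exists_mem_nhds_inter.1 hU
  have hc := continuous_graphPoint hγ.continuous e
  have hnhds : graphPoint γ e ⁻¹' (V ∩ Metric.ball x r) ∈ 𝓝 (e x 0) :=
    hc.continuousAt.preimage_mem_nhds (by
      rw [hx']; exact inter_mem hV (Metric.ball_mem_nhds x hr))
  have hsub : graphPoint γ e ⁻¹' (V ∩ Metric.ball x r) ⊆ (fun y => e y 0) '' (U ∩ frontier D) := by
    rintro a ⟨ha, hab⟩
    have hf : graphPoint γ e a ∈ frontier D := by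
      rw [h.mem_frontier_iff hD.isOpen hγ.continuous hab, graphPoint_coord_zero,
        graphPoint_coord_one]
    exact ⟨graphPoint γ e a, ⟨hVU ⟨ha, hf⟩, hf⟩, graphPoint_coord_zero _ _ _⟩
  have hlip : LipschitzWith 1 fun y : Plane => e y 0 := by
    refine LipschitzWith.of_dist_le_mul fun y z => ?_
    have h1 : |(e (y - z)) 0| ≤ ‖e (y - z)‖ := PiLp.norm_apply_le (e (y - z)) 0
    rw [e.norm_map, ← dist_eq_norm] at h1
    simp only [map_sub, PiLp.sub_apply] at h1
    simpa [Real.dist_eq] using h1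
  calc 0 < volume (graphPoint γ e ⁻¹' (V ∩ Metric.ball x r)) :=
        Measure.measure_pos_of_mem_nhds volume hnhds
    _ = Measure.hausdorffMeasure 1 (graphPoint γ e ⁻¹' (V ∩ Metric.ball x r)) := by
        rw [hausdorffMeasure_real]
    _ ≤ Measure.hausdorffMeasure 1 ((fun y => e y 0) '' (U ∩ frontier D)) := measure_mono hsub
    _ ≤ _ := by
        simpa using hlip.hausdorffMeasure_image_le (d := 1) zero_le_one (U ∩ frontier D)

/-- A continuous function on the boundary that vanishes almost everywhere vanishes everywhere. -/
theorem IsSmoothSimplyConnectedDomain.eq_zero_of_ae_eq_zero {D : Set Plane}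
    (hD : IsSmoothSimplyConnectedDomain D) {f : Plane → ℂ} (hf : ContinuousOn f (frontier D))
    (h : f =ᵐ[boundaryMeasure D] 0) : ∀ x ∈ frontier D, f x = 0 := by
  intro x hx
  by_contra h0
  have hU : {y | f y ≠ 0} ∈ 𝓝[frontier D] x :=
    (hf x hx).preimage_mem_nhdsWithin (isOpen_ne.mem_nhds h0)
  refine (hD.hausdorffMeasure_inter_frontier_pos hx hU).ne' ?_
  rw [boundaryMeasure, EventuallyEq, ae_restrict_iff' isClosed_frontier.measurableSet, ae_iff] at h
  refine measure_mono_null (fun y hy => ?_) h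
  simpa [and_comm] using hy

theorem IsSmoothSimplyConnectedDomain.memLp_of_continuousOn {D : Set Plane}
    (hD : IsSmoothSimplyConnectedDomain D) {f : Plane → ℂ} (hf : ContinuousOn f (frontier D)) :
    MemLp f 2 (boundaryMeasure D) := by
  have : IsFiniteMeasure (boundaryMeasure D) :=
    ⟨by simpa [boundaryMeasure] using hD.hausdorffMeasure_frontier_lt_top⟩
  obtain ⟨C, hC⟩ := hD.isCompact_frontier.exists_bound_of_continuousOn hf
  refine MemLp.of_bound (hf.aestronglyMeasurable isClosed_frontier.measurableSet) C ?_
  exact (ae_restrict_iff' isClosed_frontier.measurableSet).2 (.of_forall hC)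

/-! ### Finite sums of cylindrical waves -/

/-- The sum `∑_{n=-N}^N d_n J_{n+j}(kr) e^{i(n+j)θ}`. The shift `j` makes the family of these sums
stable under differentiation. -/
noncomputable def waveSum (k : ℝ) (N : ℕ) (d : Finset.Icc (-(N : ℤ)) (N : ℤ) → ℂ) (j : ℤ)
    (x : Plane) : ℂ :=
  ∑ n : Finset.Icc (-(N : ℤ)) (N : ℤ), d n * cylWave k (n + j) x

section

variable (k : ℝ) (N : ℕ) (d : Finset.Icc (-(N : ℤ)) (N : ℤ) → ℂ)

theorem hasFDerivAt_waveSum (j : ℤ) (x : Plane) :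
    HasFDerivAt (waveSum k N d j)
      (waveSum k N d (j - 1) x • scaledZ k - waveSum k N d (j + 1) x • scaledZbar k) x := by
  have h : ∀ n ∈ (Finset.univ : Finset (Finset.Icc (-(N : ℤ)) (N : ℤ))), HasFDerivAt
      (fun x => d n * cylWave k (n + j) x) (d n • (cylWave k (n + j - 1) x • scaledZ k -
        cylWave k (n + j + 1) x • scaledZbar k)) x := fun n _ =>
    (hasFDerivAt_cylWave k (n + j) x).const_mul (d n)
  refine (HasFDerivAt.fun_sum h).congr_fderiv ?_
  ext v
  simp only [waveSum, sum_apply, smul_apply,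
    sub_apply, smul_eq_mul, Finset.sum_mul, ← Finset.sum_sub_distrib]
  refine Finset.sum_congr rfl fun n _ => ?_
  rw [← add_sub_assoc, ← add_assoc]
  ring

theorem analyticOnNhd_waveSum (j : ℤ) : AnalyticOnNhd ℝ (waveSum k N d j) Set.univ := fun x _ =>
  Finset.analyticAt_fun_sum _ fun n _ => analyticAt_const.mul (analyticAt_cylWave k (n + j) x)

theorem contDiff_waveSum (j : ℤ) : ContDiff ℝ ∞ (waveSum k N d j) :=
  (analyticOnNhd_waveSum k N d j).contDiff

theorem scaledZ_single (i : Fin 2) : scaledZ k (EuclideanSpace.single i 1) =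
    if i = 0 then (k / 2 : ℂ) else k / 2 * Complex.I := by
  rw [scaledZ_apply]
  fin_cases i <;> simp

theorem scaledZbar_single (i : Fin 2) : scaledZbar k (EuclideanSpace.single i 1) =
    if i = 0 then (k / 2 : ℂ) else -(k / 2 * Complex.I) := by
  rw [scaledZbar_apply]
  fin_cases i <;> simp

theorem partialDeriv_clm_comp (L : ℂ →L[ℝ] ℝ) {f : Plane → ℂ} {f' : Plane →L[ℝ] ℂ} {x : Plane}
    (h : HasFDerivAt f f' x) (i : Fin 2) :
    partialDeriv i (fun x => L (f x)) x = L (f' (EuclideanSpace.single i 1)) := by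
  have h' : HasFDerivAt (fun x => L (f x)) (L.comp f') x := L.hasFDerivAt.comp x h
  rw [partialDeriv, h'.fderiv]
  rfl

/-- The real and imaginary parts of a sum of cylindrical waves solve the Helmholtz equation. -/
theorem planeLaplacian_waveSum (L : ℂ →L[ℝ] ℝ) (j : ℤ) (x : Plane) :
    planeLaplacian (fun x => L (waveSum k N d j x)) x = -k ^ 2 * L (waveSum k N d j x) := by
  have h1 : ∀ i, partialDeriv i (fun x => L (waveSum k N d j x)) = fun x => L
      (waveSum k N d (j - 1) x * scaledZ k (EuclideanSpace.single i 1) -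
        waveSum k N d (j + 1) x * scaledZbar k (EuclideanSpace.single i 1)) := fun i =>
    funext fun x => partialDeriv_clm_comp L (hasFDerivAt_waveSum k N d j x) i
  have h2 : ∀ (p q : ℂ), HasFDerivAt
      (fun x => waveSum k N d (j - 1) x * p - waveSum k N d (j + 1) x * q) _ x := fun p q =>
    ((hasFDerivAt_waveSum k N d (j - 1) x).mul_const p).sub
      ((hasFDerivAt_waveSum k N d (j + 1) x).mul_const q)
  rw [planeLaplacian, h1, h1, partialDeriv_clm_comp L (h2 _ _), partialDeriv_clm_comp L (h2 _ _),
    ← map_add, ← smul_eq_mul, ← map_smul]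
  congr 1
  simp only [sub_apply, smul_apply, scaledZ_single,
    scaledZbar_single, smul_eq_mul, sub_add_cancel, add_sub_cancel_right, Complex.real_smul]
  simp
  ring_nf
  simp
  ring

/-- Linear independence of the cylindrical waves on an open set: by analyticity the sum vanishes
on the plane, hence so do all its derivatives, and the derivative `∂_z^n` (or `∂_z̄^{-n}`) at the
origin is a multiple of the `n`-th coefficient. -/
theorem eq_zero_of_waveSum_eqOn_zero (hk : k ≠ 0) {D : Set Plane} (hD : IsOpen D)
    (hne : D.Nonempty) (h : ∀ x ∈ D, waveSum k N d 0 x = 0) : d = 0 := by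
  have hk' : (k / 2 : ℂ) ≠ 0 := by simpa using hk
  obtain ⟨p, hp⟩ := hne
  have h0 : waveSum k N d 0 = 0 :=
    (analyticOnNhd_waveSum k N d 0).eq_of_eventuallyEq (fun x _ => analyticAt_const)
      (z₀ := p) (by filter_upwards [hD.mem_nhds hp] with x hx using h x hx)
  have hstep : ∀ j, waveSum k N d j = 0 →
      waveSum k N d (j - 1) = 0 ∧ waveSum k N d (j + 1) = 0 := by
    intro j hj
    have hx : ∀ x, waveSum k N d (j - 1) x = 0 ∧ waveSum k N d (j + 1) x = 0 := by
      intro x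
      have hd := hasFDerivAt_waveSum k N d j x
      rw [hj] at hd
      have hz := hd.unique (hasFDerivAt_const (0 : ℂ) x)
      have e0 := congrArg (fun T => T (EuclideanSpace.single 0 1)) hz
      have e1 := congrArg (fun T => T (EuclideanSpace.single 1 1)) hz
      simp only [sub_apply, smul_apply, scaledZ_single,
        scaledZbar_single, smul_eq_mul, zero_apply, if_true,
        one_ne_zero, if_false] at e0 e1
      have f0 : waveSum k N d (j - 1) x - waveSum k N d (j + 1) x = 0 :=
        mul_right_cancel₀ hk' (by linear_combination e0)
      have f1 : waveSum k N d (j - 1) x + waveSum k N d (j + 1) x = 0 :=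
        mul_right_cancel₀ (mul_ne_zero hk' Complex.I_ne_zero) (by linear_combination e1)
      exact ⟨by linear_combination (f0 + f1) / 2, by linear_combination (f1 - f0) / 2⟩
    exact ⟨funext fun x => (hx x).1, funext fun x => (hx x).2⟩
  have hall : ∀ j, waveSum k N d j = 0 := by
    intro j
    induction j using Int.induction_on with
    | zero => exact h0
    | succ j ih => exact (hstep _ ih).2
    | pred j ih => exact (hstep _ ih).1
  funext n
  have hn := congrFun (hall (-(n : ℤ))) 0
  rw [waveSum, Finset.sum_eq_single n] at hn
  · simpa [cylWave_zero_right] using hn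
  · intro m _ hm
    rw [cylWave_zero_right, if_neg, mul_zero]
    intro h'
    exact hm (Subtype.ext (by linarith))
  · intro h'
    exact absurd (Finset.mem_univ n) h'

end

/-! ### The Robin data operator -/

/-- The normalising factor `2^|n| |n|! / (k^|n| M^|n|)` of the Fourier–Bessel functions. -/
noncomputable def amplitude (k M : ℝ) (n : ℤ) : ℂ :=
  ((2 ^ n.natAbs * (n.natAbs.factorial : ℝ) / (k ^ n.natAbs * M ^ n.natAbs) : ℝ) : ℂ)

theorem fourierBesselSum_eq (k M : ℝ) (N : ℕ) (c : Coeffs N) :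
    fourierBesselSum k M N c = waveSum k N (fun n => c n * amplitude k M n) 0 := by
  funext x
  refine Finset.sum_congr rfl fun n _ => ?_
  simp only [fourierBessel, add_zero, cylWave_eq, amplitude]
  ring

theorem contDiff_fourierBesselSum (k M : ℝ) (N : ℕ) (c : Coeffs N) :
    ContDiff ℝ ∞ (fourierBesselSum k M N c) := by
  rw [fourierBesselSum_eq]
  exact contDiff_waveSum _ _ _ _

theorem robinData_add (D : Set Plane) (k M : ℝ) (N : ℕ) (c d : Coeffs N) :
    robinData D k M N (c + d) = robinData D k M N c + robinData D k M N d := by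
  have h : fourierBesselSum k M N (c + d) =
      fun x => fourierBesselSum k M N c x + fourierBesselSum k M N d x := by
    funext x
    simp [fourierBesselSum, add_mul, Finset.sum_add_distrib]
  have hc := fun c => (contDiff_fourierBesselSum k M N c).differentiable (by simp)
  funext x
  rw [Pi.add_apply, robinData, h, fderiv_fun_add (hc c x) (hc d x), robinData, robinData,
    add_apply]
  ring

theorem robinData_smul (D : Set Plane) (k M : ℝ) (N : ℕ) (z : ℂ) (c : Coeffs N) :
    robinData D k M N (z • c) = z • robinData D k M N c := by
  have h : fourierBesselSum k M N (z • c) = fun x => z * fourierBesselSum k M N c x := by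
    funext x
    simp [fourierBesselSum, mul_assoc, Finset.mul_sum]
  have hc := (contDiff_fourierBesselSum k M N c).differentiable (by simp)
  funext x
  rw [Pi.smul_apply, robinData, h, fderiv_const_mul (hc x), robinData,
    smul_apply, smul_eq_mul, smul_eq_mul]
  ring

theorem IsSmoothSimplyConnectedDomain.continuousOn_robinData {D : Set Plane}
    (hD : IsSmoothSimplyConnectedDomain D) (k M : ℝ) (N : ℕ) (c : Coeffs N) :
    ContinuousOn (robinData D k M N c) (frontier D) := by
  have hu := contDiff_fourierBesselSum k M N c
  have h1 : ContinuousOn (fourierBesselSum k M N c) (frontier D) := hu.continuous.continuousOn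
  have h2 := (hu.continuous_fderiv (by simp)).continuousOn.clm_apply hD.continuousOn_outwardNormal
  exact (continuousOn_const.mul h1).add h2

/-- The Robin data determine the coefficients. -/
theorem IsSmoothSimplyConnectedDomain.eq_zero_of_robinData_eq_zero {D : Set Plane}
    (hD : IsSmoothSimplyConnectedDomain D) {k : ℝ} (hk : 0 < k) {M : ℝ} (hM : M ≠ 0) {N : ℕ}
    {c : Coeffs N} (h : ∀ x ∈ frontier D, robinData D k M N c x = 0) : c = 0 := by
  have hne : D.Nonempty := hD.isSimplyConnected.nonempty
  set u := fourierBesselSum k M N c with hu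
  have huw := fourierBesselSum_eq k M N c
  have hus : ContDiff ℝ ∞ u := contDiff_fourierBesselSum k M N c
  have hlap : ∀ (L : ℂ →L[ℝ] ℝ) x, planeLaplacian (fun x => L (u x)) x = -k ^ 2 * L (u x) := by
    intro L x
    rw [hu, huw]
    exact planeLaplacian_waveSum k N _ L 0 x
  have hfd : ∀ (L : ℂ →L[ℝ] ℝ), ∀ x ∈ frontier D,
      fderiv ℝ (fun x => L (u x)) x (outwardNormal D x) = L (-(Complex.I * k * u x)) := by
    intro L x hx
    have hL : HasFDerivAt (fun x => L (u x)) (L.comp (fderiv ℝ u x)) x :=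
      L.hasFDerivAt.comp x (hus.differentiable (by simp) x).hasFDerivAt
    have hx' : fderiv ℝ u x (outwardNormal D x) = -(Complex.I * k * u x) :=
      eq_neg_of_add_eq_zero_right (h x hx)
    rw [hL.fderiv, ContinuousLinearMap.comp_apply, hx']
  have hzero := hD.eqOn_zero_of_impedance hk (Complex.reCLM.contDiff.comp hus)
    (Complex.imCLM.contDiff.comp hus) (hlap Complex.reCLM) (hlap Complex.imCLM)
    (fun x hx => (hfd Complex.reCLM x hx).trans (by simp))
    (fun x hx => (hfd Complex.imCLM x hx).trans (by simp))
  have hd := eq_zero_of_waveSum_eqOn_zero k N (fun n => c n * amplitude k M n) hk.ne' hD.isOpen hne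
    (fun x hx => by
      rw [← huw]
      exact Complex.ext (hzero x hx).1 (hzero x hx).2)
  ext n
  have hn := congrFun hd n
  have ha : amplitude k M n ≠ 0 := by
    rw [amplitude, Complex.ofReal_ne_zero]
    have := Nat.factorial_ne_zero (n : ℤ).natAbs
    have := hk.ne'
    positivity
  simpa using (mul_eq_zero.1 hn).resolve_right ha

theorem lemma2p4 (D : Set Plane) (hD : IsSmoothSimplyConnectedDomain D)
    (k : ℝ) (hk : 0 < k) (M : ℝ) (hM : ∀ x ∈ closure D, ‖x‖ < M) (N : ℕ) :
    ∃ A : Coeffs N →L[ℂ] Lp ℂ 2 (boundaryMeasure D),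
      (∀ c : Coeffs N, A c =ᵐ[boundaryMeasure D] robinData D k M N c) ∧
      IsCompactOperator A ∧ Function.Injective A := by
  have hmem := fun c => hD.memLp_of_continuousOn (hD.continuousOn_robinData k M N c)
  let A₀ : Coeffs N →ₗ[ℂ] Lp ℂ 2 (boundaryMeasure D) :=
    { toFun := fun c => (hmem c).toLp
      map_add' := fun c d => by
        rw [← MemLp.toLp_add]
        exact MemLp.toLp_congr _ _ (.of_forall fun x => by rw [robinData_add])
      map_smul' := fun z c => by
        rw [RingHom.id_apply, ← MemLp.toLp_const_smul]
        exact MemLp.toLp_congr _ _ (.of_forall fun x => by rw [robinData_smul]) }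
  set A := LinearMap.toContinuousLinearMap A₀ with hA
  have hAc : ∀ c, A c =ᵐ[boundaryMeasure D] robinData D k M N c := fun c => (hmem c).coeFn_toLp
  refine ⟨A, hAc, ?_, ?_⟩
  · -- the domain is finite-dimensional, so closed balls have compact image
    refine ⟨A '' Metric.closedBall 0 1, (isCompact_closedBall _ _).image A.continuous,
      mem_of_superset (Metric.closedBall_mem_nhds 0 one_pos) (Set.subset_preimage_image _ _)⟩
  · refine (injective_iff_map_eq_zero A).2 fun c hc => ?_
    obtain ⟨p, hp⟩ := hD.isSimplyConnected.nonempty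
    have hM0 : M ≠ 0 := ((norm_nonneg p).trans_lt (hM p (subset_closure hp))).ne'
    refine hD.eq_zero_of_robinData_eq_zero hk hM0 (hD.eq_zero_of_ae_eq_zero
      (hD.continuousOn_robinData k M N c) ?_)
    have h := hAc c
    rw [hc] at h
    exact h.symm.trans (Lp.coeFn_zero _ _ _)
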